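/- Let $n,p\ge 1$ be integers with $np\ge 3$, let $\omega=e^{2\pi i/n}$ and $M_\omega(z)=\omega z$. For $1\le r\le n$, $1\le s\le p$ let $C_{r,s}$ be the geodesic of the unit disk $\mathbb D$ whose endpoints have the angles $\frac{2\pi(r-1)}{n}+\frac{2\pi(s-1)}{np}$ and $\frac{2\pi(r-1)}{n}+\frac{2\pi s}{np}$, let $J_{r,s}\subset\mathbb S^1$ be the counter-clockwise arc between these endpoints, and let $\Pi$ be the closed ideal $np$-gon in $\mathbb D$ bounded by the $C_{r,s}$. Let $g_{1,s}$ be the reflection in $C_{1,s}$ followed by the reflection in the diameter with endpoints $\pm e^{\pi i/n}$, let $g_{r,s}=M_\omega^{r-1}\circ g_{1,s}\circ M_\omega^{-(r-1)}$, and let $\Gamma_{n,p}$ be the group generated by the $g_{r,s}$. The base Bowen–Series map $A^{\rm BS}_{\Gamma_{n,p}}:\overline{\mathbb D}\setminus{\rm int}\,\Pi\to\overline{\mathbb D}$ acts as $g_{r,s}$ on the closure of the hyperbolic half-plane enclosed by $C_{r,s}$ and $J_{r,s}$ (at a vertex of $\Pi$, the piece of the arc that starts there is used; the other choice leads to the same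 factor map below). Let $\psi$ be a homeomorphism of $\overline{\mathbb D}$ that is quasiconformal on $\mathbb D$, preserves $\mathbb D$, fixes $1$, commutes with $M_\omega$, and conjugates $\Gamma_{n,p}$ to a group $\Gamma=\psi\,\Gamma_{n,p}\,\psi^{-1}$ of Möbius automorphisms of $\mathbb D$. Put $A^{\rm BS}_\Gamma=\psi\circ A^{\rm BS}_{\Gamma_{n,p}}\circ\psi^{-1}$ on $\psi(\overline{\mathbb D}\setminus{\rm int}\,\Pi)$, let $\mathcal D_\Gamma$ be the image of this set under $z\mapsto z^n$, and let the factor Bowen–Series map $A=A^{\rm fBS}_\Gamma:\mathcal D_\Gamma\to\overline{\mathbb D}$ be given by $A(z^n)=\big(A^{\rm BS}_\Gamma(z)\big)^n$. Then $A$ is well defined, continuous on $\mathcal D_\Gamma\supset\mathbb S^1$ and holomorphic in the interior of $\mathcal D_\Gamma$, and the following hold. 1. $A$ restricts to a piecewise analytic, orientation-preserving, expansive covering map $\mathbb S^1\to\mathbb S^1$ of degree $np-1$, and this restriction is topologically conjugate to $z\mapsto z^{np-1}$ on $\mathbb S^1$. (Expansive: there is $\delta>0$ such that for all $a\ne b$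 in $\mathbb S^1$ some $k\ge 0$ satisfies $|A^{k}(a)-A^{k}(b)|>\delta$.) 2. The restriction $A:A^{-1}(\mathcal D_\Gamma)\to\mathcal D_\Gamma$ has degree $np-1$, in the following sense: every point of ${\rm int}\,\mathcal D_\Gamma$ has exactly $np-1$ preimages, counted with multiplicity; $A$ maps the boundary curves $\partial\mathcal D_\Gamma\cap\mathbb D$ bijectively onto themselves; and every point of $\mathcal D_\Gamma$ has exactly $np-1$ preimages in $\mathcal D_\Gamma$ off these curves. 3. The restriction $A:A^{-1}(\overline{\mathbb D}\setminus\mathcal D_\Gamma)\to\overline{\mathbb D}\setminus\mathcal D_\Gamma$ is holomorphic of degree $np$: every point has exactly $np$ preimages, counted with multiplicity. If $n\ge 2$, then $A$ has exactly $p$ critical points in the interior of $\mathcal D_\Gamma$; all of them lie in $A^{-1}(\overline{\mathbb D}\setminus\mathcal D_\Gamma)$, each has multiplicity $n-1$, and all are mapped to $0$, which is thus the unique critical value of $A$. -/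

import Mathlib

namespace FactorBS

noncomputable section

open Complex Set Filter Topology

/-- The closed unit disk. -/
abbrev Disk : Type := Metric.closedBall (0 : ℂ) 1

theorem Disk.norm_le (z : Disk) : ‖(z : ℂ)‖ ≤ 1 := by
  have h := z.2
  rwa [Metric.mem_closedBall, dist_zero_right] at h

/-- A point of the unit circle, seen in the closed disk. -/
def bdry (u : Circle) : Disk := ⟨(u : ℂ), by
  rw [Metric.mem_closedBall, dist_zero_right, Circle.norm_coe]⟩

/-! ### Rotations and reflections of the closed disk -/

/-- The rotation `z ↦ u z`. -/
def rot (u : Circle) : Disk ≃ₜ Disk where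
  toFun z := ⟨u * z, by
    rw [Metric.mem_closedBall, dist_zero_right, norm_mul, Circle.norm_coe, one_mul]
    exact z.norm_le⟩
  invFun z := ⟨(u⁻¹ : Circle) * z, by
    rw [Metric.mem_closedBall, dist_zero_right, norm_mul, Circle.norm_coe, one_mul]
    exact z.norm_le⟩
  left_inv z := by ext; simp
  right_inv z := by ext; simp
  continuous_toFun := by fun_prop
  continuous_invFun := by fun_prop

/-- The reflection `z ↦ u conj z` in the diameter with endpoints `± √u`. -/
def lineReflection (u : Circle) : Disk ≃ₜ Disk where
  toFun z := ⟨u * (starRingEnd ℂ) z, by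
    rw [Metric.mem_closedBall, dist_zero_right, norm_mul, Circle.norm_coe, one_mul, RCLike.norm_conj]
    exact z.norm_le⟩
  invFun z := ⟨u * (starRingEnd ℂ) z, by
    rw [Metric.mem_closedBall, dist_zero_right, norm_mul, Circle.norm_coe, one_mul, RCLike.norm_conj]
    exact z.norm_le⟩
  left_inv z := by
    ext
    simp [← mul_assoc, Complex.mul_conj, Circle.normSq_coe]
  right_inv z := by
    ext
    simp [← mul_assoc, Complex.mul_conj, Circle.normSq_coe]
  continuous_toFun := by fun_prop
  continuous_invFun := by fun_prop

/-- The radius of the circle centred at `c` that is orthogonal to the unit circle. -/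
def orthRadius (c : ℂ) : ℝ := Real.sqrt (‖c‖ ^ 2 - 1)

theorem orthRadius_sq {c : ℂ} (hc : 1 < ‖c‖) : orthRadius c ^ 2 = ‖c‖ ^ 2 - 1 :=
  Real.sq_sqrt (by nlinarith)

theorem orthRadius_ne {c : ℂ} (hc : 1 < ‖c‖) : orthRadius c ≠ 0 :=
  (Real.sqrt_pos.2 (by nlinarith)).ne'

theorem Disk.ne_center {c : ℂ} (hc : 1 < ‖c‖) (z : Disk) : (z : ℂ) ≠ c := by
  rintro rfl
  exact absurd z.norm_le (not_le.2 hc)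

theorem inversion_mem {c : ℂ} (hc : 1 < ‖c‖) (z : Disk) :
    EuclideanGeometry.inversion c (orthRadius c) (z : ℂ) ∈ Metric.closedBall (0 : ℂ) 1 := by
  have hz := z.norm_le
  have hne : ‖(z : ℂ) - c‖ ^ 2 ≠ 0 := by
    have := norm_ne_zero_iff.2 (sub_ne_zero.2 (Disk.ne_center hc z))
    positivity
  rw [Metric.mem_closedBall, dist_zero_right, ← sq_le_one_iff₀ (norm_nonneg _)]
  simp only [EuclideanGeometry.inversion, vsub_eq_sub, vadd_eq_add, div_pow, orthRadius_sq hc,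
    dist_eq_norm]
  have hpos : 0 < ‖(z : ℂ) - c‖ ^ 2 := lt_of_le_of_ne (by positivity) (Ne.symm hne)
  set N := ‖(z : ℂ) - c‖ ^ 2 with hN
  have hN' : N = ((z : ℂ).re - c.re) ^ 2 + ((z : ℂ).im - c.im) ^ 2 := by
    rw [hN, Complex.sq_norm, Complex.normSq_apply]; simp; ring
  have hc2 : ‖c‖ ^ 2 = c.re ^ 2 + c.im ^ 2 := by
    rw [Complex.sq_norm, Complex.normSq_apply]; ring
  have hz2 : (z : ℂ).re ^ 2 + (z : ℂ).im ^ 2 ≤ 1 := by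
    have : ‖(z : ℂ)‖ ^ 2 = (z : ℂ).re ^ 2 + (z : ℂ).im ^ 2 := by
      rw [Complex.sq_norm, Complex.normSq_apply]; ring
    nlinarith [norm_nonneg (z : ℂ)]
  have hC : 1 < c.re ^ 2 + c.im ^ 2 := by nlinarith
  rw [Complex.sq_norm, Complex.normSq_apply]
  simp only [add_re, add_im, smul_re, smul_im, sub_re, sub_im, smul_eq_mul, hc2]
  set x := (z : ℂ).re
  set y := (z : ℂ).im
  set a := c.re
  set b := c.im
  have key : ((a ^ 2 + b ^ 2 - 1) / N * (x - a) + a) * ((a ^ 2 + b ^ 2 - 1) / N * (x - a) + a) +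
      ((a ^ 2 + b ^ 2 - 1) / N * (y - b) + b) * ((a ^ 2 + b ^ 2 - 1) / N * (y - b) + b)
      = 1 - (a ^ 2 + b ^ 2 - 1) * (1 - (x ^ 2 + y ^ 2)) / N := by
    field_simp
    rw [hN']
    ring
  rw [key]
  have : 0 ≤ (a ^ 2 + b ^ 2 - 1) * (1 - (x ^ 2 + y ^ 2)) / N :=
    div_nonneg (mul_nonneg (by linarith) (by linarith)) hpos.le
  linarith

/-- The hyperbolic reflection of the closed disk in the geodesic that lies on the circle centred at
`c` and orthogonal to the unit circle: the inversion in this circle. -/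
def geodesicReflection (c : ℂ) (hc : 1 < ‖c‖) : Disk ≃ₜ Disk where
  toFun z := ⟨EuclideanGeometry.inversion c (orthRadius c) (z : ℂ), inversion_mem hc z⟩
  invFun z := ⟨EuclideanGeometry.inversion c (orthRadius c) (z : ℂ), inversion_mem hc z⟩
  left_inv z := by
    ext
    exact EuclideanGeometry.inversion_inversion c (orthRadius_ne hc) _
  right_inv z := by
    ext
    exact EuclideanGeometry.inversion_inversion c (orthRadius_ne hc) _
  continuous_toFun := by
    refine Continuous.subtype_mk ?_ _
    exact Continuous.inversion continuous_const continuous_const continuous_subtype_val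
      (fun z => Disk.ne_center hc z)
  continuous_invFun := by
    refine Continuous.subtype_mk ?_ _
    exact Continuous.inversion continuous_const continuous_const continuous_subtype_val
      (fun z => Disk.ne_center hc z)

/-- The Möbius automorphisms of the disk. -/
def IsDiskAut (g : Disk ≃ₜ Disk) : Prop :=
  ∃ a b : ℂ, ‖b‖ < ‖a‖ ∧ ∀ z : Disk,
    (g z : ℂ) = (a * z + b) / ((starRingEnd ℂ) b * z + (starRingEnd ℂ) a)

/-! ### The base polygon, its side pairings and the base group

The indices `r`, `s` start from `0`. -/

/-- `ω = exp (2πi/n)`. -/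
def omega (n : ℕ) : Circle := Circle.exp (2 * Real.pi / n)

/-- The centre of the circle orthogonal to the unit circle that carries the geodesic `C_{r,s}` with
endpoints at the angles `2πr/n + 2πs/(np)` and `2πr/n + 2π(s+1)/(np)`. -/
def center (n p : ℕ) (r : Fin n) (s : Fin p) : ℂ :=
  Circle.exp (2 * Real.pi * r / n + 2 * Real.pi * (s + 1 / 2) / (n * p)) /
    Real.cos (Real.pi / (n * p))

theorem one_lt_norm_center {n p : ℕ} (h : 3 ≤ n * p) (r : Fin n) (s : Fin p) :
    1 < ‖center n p r s‖ := by
  have h3 : (3 : ℝ) ≤ n * p := by exact_mod_cast h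
  have hx : 0 < Real.pi / (n * p) := div_pos Real.pi_pos (by linarith)
  have hx2 : Real.pi / (n * p) < Real.pi / 2 :=
    div_lt_div_of_pos_left Real.pi_pos (by norm_num) (by linarith)
  have hc : 0 < Real.cos (Real.pi / (n * p)) :=
    Real.cos_pos_of_mem_Ioo ⟨by linarith, hx2⟩
  have hc1 : Real.cos (Real.pi / (n * p)) < 1 := by
    have := Real.cos_lt_cos_of_nonneg_of_le_pi_div_two le_rfl hx2.le hx
    rwa [Real.cos_zero] at this
  rw [center, norm_div, Circle.norm_coe, Complex.norm_real, Real.norm_of_nonneg hc.le]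
  exact (one_lt_div hc).2 hc1

/-- The closure, in the closed disk, of the hyperbolic half-plane enclosed by the geodesic
`C_{r,s}` and the arc `J_{r,s}`. -/
def halfPlane (n p : ℕ) (r : Fin n) (s : Fin p) : Set Disk :=
  {z | ‖(z : ℂ) - center n p r s‖ ≤ orthRadius (center n p r s)}

/-- The ideal `np`-gon `Π` bounded by the geodesics `C_{r,s}`, closed in the open disk. -/
def polygon (n p : ℕ) : Set ℂ :=
  {z | ‖z‖ < 1 ∧ ∀ r s, orthRadius (center n p r s) ≤ ‖z - center n p r s‖}

theorem pos_of_three_le {n p : ℕ} (h : 3 ≤ n * p) : 0 < n :=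
  Nat.pos_of_ne_zero (by rintro rfl; omega)

/-- `g_{1,s}`: the reflection in `C_{1,s}` followed by the reflection in the diameter with
endpoints `± exp (πi/n)`. -/
def pairingOne {n p : ℕ} (h : 3 ≤ n * p) (s : Fin p) : Disk ≃ₜ Disk :=
  lineReflection (omega n) *
    geodesicReflection (center n p ⟨0, pos_of_three_le h⟩ s)
      (one_lt_norm_center h ⟨0, pos_of_three_le h⟩ s)

/-- The side pairings `g_{r,s} = M_ω^r ∘ g_{1,s} ∘ M_ω^{-r}`. -/
def pairing {n p : ℕ} (h : 3 ≤ n * p) (r : Fin n) (s : Fin p) : Disk ≃ₜ Disk :=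
  rot (omega n) ^ (r : ℕ) * pairingOne h s * (rot (omega n) ^ (r : ℕ))⁻¹

/-- The base group `Γ_{n,p}`, generated by the side pairings. -/
def baseGroup {n p : ℕ} (h : 3 ≤ n * p) : Subgroup (Disk ≃ₜ Disk) :=
  Subgroup.closure {g | ∃ r s, g = pairing h r s}

/-! ### Bowen-Series map of the base group -/

/-- The half-plane of `C_{r,s}` without the endpoint of `J_{r,s}` at its counter-clockwise end.
These sets partition the complement of the interior of `Π`; a vertex of `Π` belongs to the piece
of the arc that starts there. -/
def piece (n p : ℕ) (r : Fin n) (s : Fin p) : Set Disk :=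
  halfPlane n p r s \
    {bdry (Circle.exp (2 * Real.pi * r / n + 2 * Real.pi * (s + 1) / (n * p)))}

/-- The domain of the Bowen-Series map of the base group: the closed disk without the interior of
`Π`. -/
def baseDomain (n p : ℕ) : Set Disk := {z | (z : ℂ) ∉ interior (polygon n p)}

open Classical in
/-- The Bowen-Series map of the base group: it acts as `g_{r,s}` on the half-plane of `C_{r,s}`
(and is given the irrelevant value `z` at the points `z` outside of its domain). -/
def baseBowenSeries {n p : ℕ} (h : 3 ≤ n * p) (z : Disk) : Disk :=
  if hz : ∃ i : Fin n × Fin p, z ∈ piece n p i.1 i.2 then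
    pairing h hz.choose.1 hz.choose.2 z
  else z

/-! ### Maps of the circle -/

/-- `f` has a strictly increasing continuous lift to the real line. -/
def OrientationPreserving (f : Circle → ℂ) : Prop :=
  ∃ L : ℝ → ℝ, Continuous L ∧ StrictMono L ∧ ∀ t, f (Circle.exp t) = Circle.exp (L t)

/-- The circle can be cut into finitely many closed arcs such that, on each of them, `f` is the
restriction of a map that is complex analytic in a neighbourhood of the arc. -/
def PiecewiseAnalytic (f : Circle → Circle) : Prop :=
  ∃ (N : ℕ) (t : ℕ → ℝ), StrictMono t ∧ t N = t 0 + 2 * Real.pi ∧ ∀ k < N,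
    ∃ G : ℂ → ℂ, ∀ x ∈ Icc (t k) (t (k + 1)),
      AnalyticAt ℂ G (Circle.exp x) ∧ G (Circle.exp x) = f (Circle.exp x)

/-- There is `δ > 0` such that any two distinct points are eventually more than `δ` apart at some
time of their forward orbits. -/
def Expansive (f : Circle → Circle) : Prop :=
  ∃ δ : ℝ, 0 < δ ∧ ∀ a b : Circle, a ≠ b → ∃ k : ℕ, δ < dist (f^[k] a) (f^[k] b)

/-- `f` is a covering map, all of whose fibres have `d` points. -/
def IsCoveringOfDegree (f : Circle → Circle) (d : ℕ) : Prop :=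
  IsCoveringMap f ∧ ∀ z, (f ⁻¹' {z}).Finite ∧ (f ⁻¹' {z}).ncard = d

/-- `f` is topologically conjugate to `z ↦ z ^ d`. -/
def ConjugateToPower (f : Circle → Circle) (d : ℕ) : Prop :=
  ∃ H : Circle ≃ₜ Circle, ∀ z, H (z ^ d) = f (H z)

/-! ### Holomorphic maps of finite degree -/

/-- The holomorphic map `F : U → V` has degree `d`: each point of `V` has exactly `d` preimages in
`U`, counted with multiplicity. -/
def HasDegree (F : ℂ → ℂ) (U V : Set ℂ) (d : ℕ) : Prop :=
  AnalyticOnNhd ℂ F U ∧ MapsTo F U V ∧ ∀ w ∈ V, {z ∈ U | F z = w}.Finite ∧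
    ∑ᶠ z ∈ {z ∈ U | F z = w}, analyticOrderAt (fun x => F x - w) z = d

/-! ### Deformations of the base group and factor Bowen-Series maps -/

/-- Quasiconformality of a homeomorphism of the closed disk that preserves the open disk: it
preserves the orientation, and its linear dilatation
`limsup_{r → 0} max_{|x-z|=r} |ψ x - ψ z| / min_{|y-z|=r} |ψ y - ψ z|` is bounded on the open
disk. -/
def IsQuasiconformal (ψ : Disk ≃ₜ Disk) : Prop :=
  (∀ z : Disk, ‖(ψ z : ℂ)‖ < 1 ↔ ‖(z : ℂ)‖ < 1) ∧
  OrientationPreserving (fun u => (ψ (bdry u) : ℂ)) ∧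
  ∃ K : ℝ, ∀ z : Disk, ‖(z : ℂ)‖ < 1 → ∀ᶠ r : ℝ in 𝓝[>] 0, ∀ x y : Disk,
    dist x z = r → dist y z = r → dist (ψ x) (ψ z) ≤ K * dist (ψ y) (ψ z)

/-- `ψ` induces an element `ρ : Γ_{n,p} → Γ`, `ρ g = ψ ∘ g ∘ ψ⁻¹`, of `Teich^ω(Γ_{n,p})`: it is a
quasiconformal homeomorphism that preserves the disk, fixes `1`, commutes with `M_ω` and
conjugates the base group to a group of Möbius automorphisms of the disk. -/
structure InducesTeichOmega {n p : ℕ} (h : 3 ≤ n * p) (ψ : Disk ≃ₜ Disk) : Prop where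
  quasiconformal : IsQuasiconformal ψ
  map_one : ψ (bdry 1) = bdry 1
  map_omega : ∀ z, ψ (rot (omega n) z) = rot (omega n) (ψ z)
  conj_mem : ∀ g ∈ baseGroup h, IsDiskAut (ψ * g * ψ⁻¹)

/-- The Bowen-Series map of `Γ = ψ Γ_{n,p} ψ⁻¹` with fundamental domain `ψ(Π)`. -/
def bowenSeries {n p : ℕ} (h : 3 ≤ n * p) (ψ : Disk ≃ₜ Disk) (z : Disk) : Disk :=
  ψ (baseBowenSeries h (ψ.symm z))

/-- The domain of the Bowen-Series map of `Γ`. -/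
def bowenSeriesDomain (n p : ℕ) (ψ : Disk ≃ₜ Disk) : Set Disk := ψ '' baseDomain n p

/-- `𝒟_Γ`, the image of the domain of the Bowen-Series map under the quotient of the disk by
`M_ω`, which is identified with the disk by `z ↦ z ^ n`. -/
def factorDomain (n p : ℕ) (ψ : Disk ≃ₜ Disk) : Set ℂ :=
  (fun z : Disk => (z : ℂ) ^ n) '' bowenSeriesDomain n p ψ

open Classical in
/-- The factor Bowen-Series map `A_Γ^{fBS}`: it sends `z ^ n` to `(A_Γ^{BS} z) ^ n`. -/
def factorBowenSeries {n p : ℕ} (h : 3 ≤ n * p) (ψ : Disk ≃ₜ Disk) (w : ℂ) : ℂ :=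
  if hw : ∃ z : Disk, (z : ℂ) ^ n = w then (bowenSeries h ψ hw.choose : ℂ) ^ n else 0

/-- The boundary of `𝒟_Γ` in the open disk. -/
def boundaryCurves (n p : ℕ) (ψ : Disk ≃ₜ Disk) : Set ℂ :=
  frontier (factorDomain n p ψ) ∩ Metric.ball 0 1

/-- The critical points of `A_Γ^{fBS}`. -/
def criticalPoints {n p : ℕ} (h : 3 ≤ n * p) (ψ : Disk ≃ₜ Disk) : Set ℂ :=
  {z ∈ interior (factorDomain n p ψ) | deriv (factorBowenSeries h ψ) z = 0}

/-- `(A_Γ^{fBS})⁻¹(V)`, for a subset `V` of the closed disk. -/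
def factorPreimage {n p : ℕ} (h : 3 ≤ n * p) (ψ : Disk ≃ₜ Disk) (V : Set ℂ) : Set ℂ :=
  {z ∈ factorDomain n p ψ | factorBowenSeries h ψ z ∈ V}

end

end FactorBS

/-!
Numbering the sides of the regular ideal polygon counter-clockwise, the base Bowen-Series map acts
on a half-plane as the reflection in its side followed by a reflection of the whole polygon. On the
circle it lifts to a map `F` of the real line for which `F x - x` is strictly increasing. The
limit of `F^[k] x / d ^ k` is then a homeomorphism of the line that conjugates `F` to multiplication
by the degree `d`, and expansivity and the covering property are inherited from `z ↦ z ^ d`.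

Modulo `M_ω`, a preimage of a point `w` is the image of a lift `y` of `w` under the inverse of one
of the `p` side pairings, so there are `np` candidates. Such a candidate lies in the half-plane of
its pairing unless `y` lies in the half-plane that is paired with it. Exactly one candidate is lost
in this way if `w` lies in `𝒟_Γ`, and none otherwise: this is why the degree is `np - 1` over `𝒟_Γ`
and `np` over its complement.

In the interior of `𝒟_Γ` the factor map is locally `B ^ n` with `B` univalent: a branch of the
`n`-th root followed by a Möbius map and the `n`-th power. Hence its critical points are its zeros,
of which there are `p`, one for each side pairing.
-/

namespace FactorBS

noncomputable section

open Complex Set Filter Topology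

open scoped AddConstMap

/-! ### Expanding lifts of circle maps -/

section Lift

variable {T : ℝ} {d : ℕ}

theorem iterate_add_period (F : ℝ →+c[T, d • T] ℝ) (k : ℕ) (x : ℝ) :
    F^[k] (x + T) = F^[k] x + d ^ k • T := by
  induction k with
  | zero => simp
  | succ k ih =>
    rw [Function.iterate_succ_apply', Function.iterate_succ_apply' F k x, ih,
      AddConstMapClass.map_add_nsmul, smul_smul, pow_succ]

theorem periodic_map_sub_mul (F : ℝ →+c[T, d • T] ℝ) :
    Function.Periodic (fun x => F x - d * x) T := fun x => by
  simp only [AddConstMapClass.map_add_const, nsmul_eq_mul]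
  ring

theorem surjective_of_continuous_addConstMap (hT : 0 < T) (g : ℝ →+c[T, T] ℝ) (hg : Continuous g) :
    Function.Surjective g := by
  intro y
  obtain ⟨m, hm⟩ := exists_int_gt ((y - g 0) / T)
  obtain ⟨k, hk⟩ := exists_int_lt ((y - g 0) / T)
  rw [div_lt_iff₀ hT] at hm
  rw [lt_div_iff₀ hT] at hk
  refine mem_range_of_exists_le_of_exists_ge hg ⟨k • T, ?_⟩ ⟨m • T, ?_⟩ <;>
    rw [AddConstMapClass.map_zsmul_const, zsmul_eq_mul] <;> linarith

/-- The `k`-th term of the series of `linearization F d`. -/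
def linearizationTerm (F : ℝ → ℝ) (d k : ℕ) (x : ℝ) : ℝ :=
  (F (F^[k] x) - d * F^[k] x) / d ^ (k + 1)

/-- The limit of `F^[k] x / d ^ k`, which semiconjugates a lift `F` of a circle map of degree `d`
to the multiplication by `d`. It is written as a series whose partial sums are these quotients. -/
def linearization (F : ℝ → ℝ) (d : ℕ) (x : ℝ) : ℝ := x + ∑' k, linearizationTerm F d k x

theorem add_sum_linearizationTerm (hd : d ≠ 0) (F : ℝ → ℝ) (K : ℕ) (x : ℝ) :
    x + ∑ k ∈ Finset.range K, linearizationTerm F d k x = F^[K] x / d ^ K := by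
  induction K with
  | zero => simp
  | succ K ih =>
    rw [Finset.sum_range_succ, ← add_assoc, ih, Function.iterate_succ_apply', linearizationTerm]
    field_simp
    ring

theorem linearizationTerm_map (hd : d ≠ 0) (F : ℝ → ℝ) (k : ℕ) (x : ℝ) :
    linearizationTerm F d k (F x) = d * linearizationTerm F d (k + 1) x := by
  simp only [linearizationTerm, Function.iterate_succ_apply, pow_succ _ (k + 1)]
  field_simp

section Continuous

variable {F : ℝ →+c[T, d • T] ℝ}

theorem exists_norm_linearizationTerm_le (hT : T ≠ 0) (hF : Continuous F) :
    ∃ C, ∀ k x, ‖linearizationTerm F d k x‖ ≤ C * (d⁻¹ : ℝ) ^ (k + 1) := by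
  obtain ⟨C, hC⟩ := isBounded_iff_forall_norm_le.1
    ((periodic_map_sub_mul F).isBounded_of_continuous hT (by fun_prop))
  refine ⟨C, fun k x => ?_⟩
  rw [linearizationTerm, norm_div, norm_pow, Real.norm_natCast, inv_pow, ← div_eq_mul_inv]
  gcongr
  exact hC _ ⟨F^[k] x, rfl⟩

theorem summable_const_mul_inv_pow_succ (hd : 2 ≤ d) (C : ℝ) :
    Summable fun k : ℕ => C * (d⁻¹ : ℝ) ^ (k + 1) :=
  ((summable_nat_add_iff 1).2 (summable_geometric_of_lt_one (by positivity)
    (inv_lt_one_of_one_lt₀ (by exact_mod_cast hd)))).mul_left C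

theorem summable_linearizationTerm (hT : T ≠ 0) (hd : 2 ≤ d) (hF : Continuous F) (x : ℝ) :
    Summable fun k => linearizationTerm F d k x :=
  have ⟨C, hC⟩ := exists_norm_linearizationTerm_le hT hF
  .of_norm_bounded (summable_const_mul_inv_pow_succ hd C) fun k => hC k x

theorem continuous_linearization (hT : T ≠ 0) (hd : 2 ≤ d) (hF : Continuous F) :
    Continuous (linearization F d) := by
  obtain ⟨C, hC⟩ := exists_norm_linearizationTerm_le hT hF
  have hterm (k : ℕ) : Continuous (linearizationTerm F d k) :=
    ((hF.comp (hF.iterate k)).sub ((hF.iterate k).const_mul _)).div_const _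
  exact continuous_id.add (continuous_tsum hterm (summable_const_mul_inv_pow_succ hd C) hC)

theorem tendsto_linearization (hT : T ≠ 0) (hd : 2 ≤ d) (hF : Continuous F) (x : ℝ) :
    Tendsto (fun K : ℕ => F^[K] x / (d : ℝ) ^ K) atTop (𝓝 (linearization F d x)) := by
  simp_rw [← add_sum_linearizationTerm (by omega : d ≠ 0)]
  exact (summable_linearizationTerm hT hd hF x).hasSum.tendsto_sum_nat.const_add x

theorem linearization_map (hT : T ≠ 0) (hd : 2 ≤ d) (hF : Continuous F) (x : ℝ) :
    linearization F d (F x) = d * linearization F d x := by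
  have hd0 : d ≠ 0 := by omega
  simp only [linearization, linearizationTerm_map hd0, tsum_mul_left]
  rw [(summable_linearizationTerm hT hd hF x).tsum_eq_zero_add]
  simp only [linearizationTerm, Function.iterate_zero, id_eq, zero_add, pow_one]
  field_simp
  ring

end Continuous

theorem linearization_add_period (F : ℝ →+c[T, d • T] ℝ) (x : ℝ) :
    linearization F d (x + T) = linearization F d x + T := by
  have hterm (k : ℕ) : linearizationTerm F d k (x + T) = linearizationTerm F d k x := by
    have hper := (periodic_map_sub_mul F).nsmul (d ^ k) (F^[k] x)
    simp only [linearizationTerm, iterate_add_period]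
    rw [hper]
  simp only [linearization, hterm]
  ring

theorem exists_pos_add_le_map_sub (hT : 0 < T) (F : ℝ →+c[T, d • T] ℝ) (hF : Continuous F)
    (hexp : StrictMono fun x => F x - x) {a : ℝ} (ha : 0 < a) (b : ℝ) :
    ∃ ε > 0, ∀ x, ∀ δ ∈ Icc a b, δ + ε ≤ F (x + δ) - F x := by
  rcases lt_or_ge b a with hba | hab
  · exact ⟨1, one_pos, fun x δ hδ => absurd (hδ.1.trans hδ.2) hba.not_ge⟩
  set gain : ℝ × ℝ → ℝ := fun q => F (q.1 + q.2) - F q.1 - q.2 with hgain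
  have hperiodic (δ : ℝ) : Function.Periodic (fun x => gain (x, δ)) T := fun x => by
    simp only [hgain, add_right_comm x T δ, AddConstMapClass.map_add_const]
    ring
  obtain ⟨q, hq, hmin⟩ := (isCompact_Icc.prod isCompact_Icc).exists_isMinOn
    (⟨(0, a), ⟨le_rfl, hT.le⟩, le_rfl, hab⟩ : (Icc 0 T ×ˢ Icc a b).Nonempty)
    (by fun_prop : ContinuousOn gain _)
  refine ⟨gain q, ?_, fun x δ hδ => ?_⟩
  · have := hexp (by linarith [hq.2.1] : q.1 < q.1 + q.2)
    simp only [hgain]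
    linarith
  · obtain ⟨y, hy, hxy⟩ := (hperiodic δ).exists_mem_Ico₀ hT x
    have hle : gain q ≤ gain (y, δ) := hmin ⟨Ico_subset_Icc_self hy, hδ⟩
    simp only [← hxy] at hle
    simp only [hgain] at hle ⊢
    linarith

theorem exists_lt_iterate_sub (hT : 0 < T) (F : ℝ →+c[T, d • T] ℝ) (hF : Continuous F)
    (hexp : StrictMono fun x => F x - x) {x y : ℝ} (hxy : x < y) (C : ℝ) :
    ∃ k : ℕ, C < F^[k] y - F^[k] x := by
  by_contra! hC
  obtain ⟨ε, hε, hgain⟩ := exists_pos_add_le_map_sub hT F hF hexp (sub_pos.2 hxy) C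
  have hgrow (k : ℕ) : y - x + k * ε ≤ F^[k] y - F^[k] x := by
    induction k with
    | zero => simp
    | succ k ih =>
      have hk : (0 : ℝ) ≤ k * ε := by positivity
      have hstep := hgain (F^[k] x) (F^[k] y - F^[k] x) ⟨by linarith, hC k⟩
      rw [add_sub_cancel] at hstep
      rw [Function.iterate_succ_apply', Function.iterate_succ_apply']
      push_cast
      linarith
  obtain ⟨k, hk⟩ := exists_nat_gt (C / ε)
  rw [div_lt_iff₀ hε] at hk
  linarith [hgrow k, hC k]

theorem strictMono_of_strictMono_sub_self {F : ℝ → ℝ} (hexp : StrictMono fun x => F x - x) :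
    StrictMono F := fun x y hxy => by
  have := hexp hxy
  simp only at this
  linarith

theorem strictMono_linearization (hT : 0 < T) (hd : 2 ≤ d) {F : ℝ →+c[T, d • T] ℝ}
    (hF : Continuous F) (hexp : StrictMono fun x => F x - x) :
    StrictMono (linearization F d) := by
  have hmono : Monotone (linearization F d) := fun x y hxy =>
    le_of_tendsto_of_tendsto' (tendsto_linearization hT.ne' hd hF x)
      (tendsto_linearization hT.ne' hd hF y) fun K => by
        have := (strictMono_of_strictMono_sub_self hexp).monotone.iterate K hxy
        gcongr
  refine fun x y hxy => (hmono hxy.le).lt_of_ne fun heq => ?_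
  -- The orbits of `x` and `y` have equal images, so they stay within one period of each other.
  have hiter (k : ℕ) : linearization F d (F^[k] x) = linearization F d (F^[k] y) := by
    induction k with
    | zero => exact heq
    | succ k ih => simp only [Function.iterate_succ_apply', linearization_map hT.ne' hd hF, ih]
  obtain ⟨k, hk⟩ := exists_lt_iterate_sub hT F hF hexp hxy T
  have hle := hmono (by linarith : F^[k] x + T ≤ F^[k] y)
  rw [linearization_add_period, hiter] at hle
  linarith

theorem exists_strictMono_semiconj_mul (hT : 0 < T) (hd : 2 ≤ d) (F : ℝ →+c[T, d • T] ℝ)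
    (hF : Continuous F) (hexp : StrictMono fun x => F x - x) :
    ∃ g : ℝ →+c[T, T] ℝ, Continuous g ∧ StrictMono g ∧ ∀ x, g (F x) = d * g x :=
  ⟨⟨linearization F d, linearization_add_period F⟩, continuous_linearization hT.ne' hd hF,
    strictMono_linearization hT hd hF hexp, linearization_map hT.ne' hd hF⟩

end Lift

theorem exists_circleHomeomorph_of_lift (g : ℝ →+c[2 * Real.pi, 2 * Real.pi] ℝ)
    (hg : Continuous g) (hmono : StrictMono g) :
    ∃ H : Circle ≃ₜ Circle, ∀ x, H (Circle.exp x) = Circle.exp (g x) := by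
  have hexp_iff (x y : ℝ) :
      Circle.exp (g x) = Circle.exp (g y) ↔ Circle.exp x = Circle.exp y := by
    simp only [Circle.exp_eq_exp, ← zsmul_eq_mul, ← AddConstMapClass.map_add_zsmul,
      hmono.injective.eq_iff]
  set H : Circle → Circle := fun u => Circle.exp (g (arg u))
  have hlift (x : ℝ) : H (Circle.exp x) = Circle.exp (g x) :=
    (hexp_iff _ _).2 (Circle.exp_arg _)
  have hcont : Continuous H := by
    have hquot : IsQuotientMap Circle.exp :=
      Circle.isCoveringMap_exp.isQuotientMap Circle.exp_surjective
    rw [hquot.continuous_iff, show H ∘ Circle.exp = Circle.exp ∘ g from funext hlift]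
    exact Circle.exp.continuous.comp hg
  have hbij : Function.Bijective H := by
    refine ⟨fun u v huv => ?_, fun w => ?_⟩
    · obtain ⟨x, rfl⟩ := Circle.exp_surjective u
      obtain ⟨y, rfl⟩ := Circle.exp_surjective v
      rwa [hlift, hlift, hexp_iff] at huv
    · obtain ⟨y, rfl⟩ := Circle.exp_surjective w
      obtain ⟨x, rfl⟩ := surjective_of_continuous_addConstMap Real.two_pi_pos g hg y
      exact ⟨Circle.exp x, hlift x⟩
  exact ⟨Continuous.homeoOfEquivCompactToT2 (f := Equiv.ofBijective H hbij) hcont, hlift⟩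

/-! ### The power maps of the circle -/

theorem encard_setOf_pow_eq {n : ℕ} (hn : n ≠ 0) {w : ℂ} (hw : w ≠ 0) :
    {z : ℂ | z ^ n = w}.encard = n := by
  classical
  have hζ := isPrimitiveRoot_exp n hn
  have hset : {z : ℂ | z ^ n = w} = (Polynomial.nthRoots n w).toFinset := by
    ext z
    simp [Polynomial.mem_nthRoots hn.bot_lt]
  rw [hset, encard_coe_eq_coe_finsetCard, Multiset.toFinset_card_of_nodup (hζ.nthRoots_nodup hw),
    hζ.card_nthRoots, if_pos (IsAlgClosed.exists_pow_nat_eq w hn.bot_lt)]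

theorem encard_setOf_circle_pow_eq {d : ℕ} (hd : d ≠ 0) (u : Circle) :
    {v : Circle | v ^ d = u}.encard = d := by
  have hset : ((↑) : Circle → ℂ) '' {v | v ^ d = u} = {z : ℂ | z ^ d = u} := by
    ext z
    constructor
    · rintro ⟨v, rfl, rfl⟩
      exact (Circle.coe_pow v d).symm
    · intro hz
      have hnorm : ‖z‖ = 1 := by
        rw [← pow_eq_one_iff_of_nonneg (norm_nonneg z) hd, ← norm_pow, hz, Circle.norm_coe]
      exact ⟨⟨z, mem_sphere_zero_iff_norm.2 hnorm⟩, Circle.ext hz, rfl⟩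
  exact (Circle.coe_injective.encard_image _).symm.trans
    (hset ▸ encard_setOf_pow_eq hd u.coe_ne_zero)

theorem dist_circle_pow_pow (a b : Circle) (k : ℕ) :
    dist (a ^ k) (b ^ k) = ‖((a / b : Circle) : ℂ) ^ k - 1‖ := by
  rw [Circle.coe_div, div_pow, div_sub_one (pow_ne_zero _ b.coe_ne_zero), norm_div, norm_pow,
    Circle.norm_coe, one_pow, div_one]
  exact dist_eq_norm (a ^ k : ℂ) (b ^ k : ℂ)

theorem exists_lt_norm_pow_sub_one {d : ℕ} (hd : 2 ≤ d) {c : Circle} (hc : c ≠ 1) :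
    ∃ k : ℕ, 2 / (d : ℝ) < ‖(c : ℂ) ^ d ^ k - 1‖ := by
  have hd1 : (1 : ℝ) < d := by exact_mod_cast hd
  have hπ := Real.pi_pos
  obtain ⟨t, ht0, htπ, rfl⟩ : ∃ t : ℝ, 0 < |t| ∧ |t| ≤ Real.pi ∧ Circle.exp t = c :=
    ⟨arg c, abs_pos.2 fun h0 => hc (by rw [← Circle.exp_arg c, h0, Circle.exp_zero]),
      abs_arg_le_pi c, Circle.exp_arg c⟩
  obtain ⟨k, hk, hk'⟩ := exists_nat_pow_near ((one_le_div ht0).2 htπ) hd1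
  rw [le_div_iff₀ ht0] at hk
  rw [div_lt_iff₀ ht0, pow_succ] at hk'
  refine ⟨k, ?_⟩
  set s : ℝ := d ^ k * t with hs
  have habs : |s / 2| = d ^ k * |t| / 2 := by
    rw [hs, abs_div, abs_mul, abs_of_nonneg (by positivity : (0 : ℝ) ≤ d ^ k), abs_two]
  have hsin : 2 / Real.pi * |s / 2| ≤ |Real.sin (s / 2)| :=
    Real.mul_abs_le_abs_sin (by rw [habs]; linarith)
  have hnorm : ‖(Circle.exp t : ℂ) ^ d ^ k - 1‖ = 2 * |Real.sin (s / 2)| := by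
    rw [← Circle.coe_pow, ← Circle.exp_natCast_mul, Circle.coe_exp, mul_comm (ofReal _),
      norm_exp_I_mul_ofReal_sub_one, norm_mul, Real.norm_ofNat, Real.norm_eq_abs, Nat.cast_pow]
  rw [hnorm, div_lt_iff₀ (by linarith)]
  calc 2 < 2 * (2 / Real.pi * |s / 2| * d) := by
        rw [habs]
        field_simp
        linarith
    _ ≤ 2 * |Real.sin (s / 2)| * d := by
        rw [mul_assoc 2]
        gcongr

theorem ConjugateToPower.expansive {f : Circle → Circle} {d : ℕ} (hd : 2 ≤ d)
    (hf : ConjugateToPower f d) : Expansive f := by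
  obtain ⟨H, hH⟩ := hf
  have hsemi (k : ℕ) (u : Circle) : H.symm (f^[k] u) = H.symm u ^ d ^ k := by
    induction k with
    | zero => simp
    | succ k ih =>
      rw [Function.iterate_succ_apply', pow_succ, pow_mul, ← ih, Homeomorph.symm_apply_eq, hH,
        Homeomorph.apply_symm_apply]
  have hunif : UniformContinuous H.symm :=
    CompactSpace.uniformContinuous_of_continuous H.symm.continuous
  obtain ⟨δ, hδ, hδ'⟩ := Metric.uniformContinuous_iff.1 hunif (2 / (d : ℝ)) (by positivity)
  refine ⟨δ / 2, by linarith, fun a b hab => ?_⟩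
  obtain ⟨k, hk⟩ := exists_lt_norm_pow_sub_one hd (div_ne_one.2 (H.symm.injective.ne hab))
  refine ⟨k, ?_⟩
  by_contra! hclose
  have hlt := hδ' (by linarith : dist (f^[k] a) (f^[k] b) < δ)
  rw [hsemi, hsemi, dist_circle_pow_pow] at hlt
  exact hlt.not_gt hk

theorem ConjugateToPower.isCoveringOfDegree {f : Circle → Circle} {d : ℕ} (hd : d ≠ 0)
    (hf : ConjugateToPower f d) : IsCoveringOfDegree f d := by
  obtain ⟨H, hH⟩ := hf
  have : NeZero d := ⟨hd⟩
  have hconj : f = H ∘ (fun u : Circle => u ^ d) ∘ H.symm := by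
    funext u
    simp [hH]
  refine ⟨?_, fun z => ?_⟩
  · rw [hconj]
    exact ((Circle.isQuotientCoveringMap_npow d).isCoveringMap.comp_homeomorph
      H.symm).homeomorph_comp H
  · have hset : f ⁻¹' {z} = H '' {v | v ^ d = H.symm z} := by
      ext u
      rw [H.image_eq_preimage_symm, hconj]
      simp [Homeomorph.eq_symm_apply]
    have hcard : (f ⁻¹' {z}).encard = d := by
      rw [hset, H.injective.encard_image, encard_setOf_circle_pow_eq hd]
    exact ⟨finite_of_encard_eq_coe hcard, by rw [ncard, hcard, ENat.toNat_natCast]⟩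

/-! ### Reflection in a geodesic on the circle -/

theorem inversion_orthRadius {c z : ℂ} (hc : 1 < ‖c‖) (hz : z ≠ c) :
    EuclideanGeometry.inversion c (orthRadius c) z =
      (c * (starRingEnd ℂ) z - 1) / ((starRingEnd ℂ) z - (starRingEnd ℂ) c) := by
  have hne : z - c ≠ 0 := sub_ne_zero.2 hz
  have hne' : (starRingEnd ℂ) z - (starRingEnd ℂ) c ≠ 0 := by
    rwa [← map_sub, map_ne_zero]
  have hsq : ((‖z - c‖ : ℝ) : ℂ) ^ 2 = (z - c) * ((starRingEnd ℂ) z - (starRingEnd ℂ) c) := by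
    rw [← map_sub, mul_conj']
  rw [EuclideanGeometry.inversion, dist_eq_norm, vsub_eq_sub, vadd_eq_add, div_pow,
    orthRadius_sq hc, Complex.real_smul]
  push_cast
  rw [hsq, ← mul_conj' c]
  field_simp
  ring

theorem coe_circleExp_eq_div {t : ℝ} (ht : Real.cos (t / 2) ≠ 0) :
    (Circle.exp t : ℂ) = (1 + Real.tan (t / 2) * I) / (1 - Real.tan (t / 2) * I) := by
  have hc : Complex.cos (t / 2) ≠ 0 := by exact_mod_cast ht
  have hhalf : 1 - Complex.tan (t / 2) * I = Complex.exp (-(t / 2) * I) / Complex.cos (t / 2) := by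
    rw [Complex.exp_mul_I, Complex.cos_neg, Complex.sin_neg, Complex.tan]
    field_simp
    ring
  have hhalf' : 1 + Complex.tan (t / 2) * I = Complex.exp (t / 2 * I) / Complex.cos (t / 2) := by
    rw [Complex.exp_mul_I, Complex.tan]
    field_simp
  push_cast
  rw [hhalf, hhalf', div_div_div_cancel_right₀ hc, ← Complex.exp_sub]
  ring_nf

/-- The reflection in the geodesic with endpoints `exp (± i α)` maps `exp (i t)` to
`exp (- i reflectAngle α t)`. -/
def reflectAngle (α t : ℝ) : ℝ :=
  Real.pi + 2 * Real.arctan (Real.tan (t / 2) / Real.tan (α / 2) ^ 2)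

section ReflectAngle

variable {α : ℝ}

theorem tan_half_pos (h0 : 0 < α) (h1 : α < Real.pi / 2) : 0 < Real.tan (α / 2) :=
  Real.tan_pos_of_pos_of_lt_pi_div_two (by linarith) (by linarith [Real.pi_pos])

theorem cos_half_pos {t : ℝ} (h1 : α < Real.pi / 2) (ht : t ∈ Icc (-α) α) :
    0 < Real.cos (t / 2) :=
  Real.cos_pos_of_mem_Ioo ⟨by linarith [ht.1, Real.pi_pos], by linarith [ht.2, Real.pi_pos]⟩

theorem reflectAngle_right (h0 : 0 < α) (h1 : α < Real.pi / 2) :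
    reflectAngle α α = 2 * Real.pi - α := by
  have htan := tan_half_pos h0 h1
  rw [reflectAngle, sq, div_mul_cancel_left₀ htan.ne', Real.arctan_inv_of_pos htan,
    Real.arctan_tan (by linarith) (by linarith)]
  ring

theorem reflectAngle_left (h0 : 0 < α) (h1 : α < Real.pi / 2) : reflectAngle α (-α) = α := by
  have hright := reflectAngle_right h0 h1
  rw [reflectAngle] at hright ⊢
  rw [neg_div, Real.tan_neg, neg_div, Real.arctan_neg]
  linarith

theorem hasDerivAt_reflectAngle {t : ℝ} (hα : Real.tan (α / 2) ≠ 0) (ht : Real.cos (t / 2) ≠ 0) :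
    HasDerivAt (reflectAngle α) (Real.tan (α / 2) ^ 2 * (1 + Real.tan (t / 2) ^ 2) /
      (Real.tan (α / 2) ^ 4 + Real.tan (t / 2) ^ 2)) t := by
  have hderiv := ((((Real.hasDerivAt_tan ht).comp t ((hasDerivAt_id t).div_const 2)).div_const
    (Real.tan (α / 2) ^ 2)).arctan.const_mul 2).const_add Real.pi
  refine hderiv.congr_deriv ?_
  rw [one_div (Real.cos _ ^ 2), ← Real.inv_one_add_tan_sq ht, inv_inv, Function.comp_apply, id]
  have : Real.tan (α / 2) ^ 4 + Real.tan (t / 2) ^ 2 ≠ 0 := by positivity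
  field_simp

theorem strictMonoOn_reflectAngle_sub_self (h0 : 0 < α) (h1 : α < Real.pi / 2) :
    StrictMonoOn (fun t => reflectAngle α t - t) (Icc (-α) α) := by
  have hτ := tan_half_pos h0 h1
  have hderiv (t : ℝ) (ht : t ∈ Icc (-α) α) :=
    (hasDerivAt_reflectAngle hτ.ne' (cos_half_pos h1 ht).ne').sub (hasDerivAt_id t)
  refine strictMonoOn_of_deriv_pos (convex_Icc _ _)
    (fun t ht => (hderiv t ht).continuousAt.continuousWithinAt) fun t ht => ?_
  rw [interior_Icc] at ht
  refine lt_of_lt_of_eq ?_ (hderiv t (Ioo_subset_Icc_self ht)).deriv.symm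
  have hτ1 : Real.tan (α / 2) < 1 := by
    rw [← Real.tan_pi_div_four]
    exact Real.tan_lt_tan_of_lt_of_lt_pi_div_two (by linarith) (by linarith) (by linarith)
  have hut : Real.tan (t / 2) < Real.tan (α / 2) :=
    Real.tan_lt_tan_of_lt_of_lt_pi_div_two (by linarith [ht.1]) (by linarith) (by linarith [ht.2])
  have hut' : -Real.tan (α / 2) < Real.tan (t / 2) := by
    rw [← Real.tan_neg]
    exact Real.tan_lt_tan_of_lt_of_lt_pi_div_two (by linarith) (by linarith [ht.2])
      (by linarith [ht.1])
  generalize Real.tan (α / 2) = τ at *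
  generalize Real.tan (t / 2) = u at *
  rw [sub_pos, lt_div_iff₀ (by positivity)]
  have hu2 : u ^ 2 < τ ^ 2 := sq_lt_sq' hut' hut
  have hτ2 : τ ^ 2 < 1 := pow_lt_one₀ hτ.le hτ1 two_ne_zero
  -- `τ² (1 + u²) - (τ⁴ + u²) = (τ² - u²) (1 - τ²)`
  linarith [mul_pos (sub_pos.2 hu2) (sub_pos.2 hτ2)]

theorem coe_circleExp_neg_reflectAngle (h0 : 0 < α) (h1 : α < Real.pi / 2) {t : ℝ}
    (ht : t ∈ Icc (-α) α) : (Circle.exp (-reflectAngle α t) : ℂ) =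
      (1 - Real.cos α * Circle.exp t) / (Real.cos α - Circle.exp t) := by
  have hcos : Real.cos α = (1 - Real.tan (α / 2) ^ 2) / (1 + Real.tan (α / 2) ^ 2) :=
    Real.cos_eq_two_mul_tan_half_div_one_sub_tan_half_sq α
      (by linarith [Real.cos_pos_of_mem_Ioo (⟨by linarith, h1⟩ : α ∈ Ioo (-(Real.pi / 2)) _)])
  have hexp (x : ℝ) : (Circle.exp (2 * Real.arctan x) : ℂ) = (1 + x * I) / (1 - x * I) := by
    rw [coe_circleExp_eq_div] <;> rw [mul_div_cancel_left₀ _ two_ne_zero]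
    · rw [Real.tan_arctan]
    · exact (Real.cos_arctan_pos x).ne'
  have hne {a : ℝ} (ha : a ≠ 0) (b : ℝ) : (a : ℂ) + b * I ≠ 0 := fun h0 => by
    simpa [ha] using congrArg Complex.re h0
  rw [coe_circleExp_eq_div (cos_half_pos h1 ht).ne', hcos, reflectAngle, neg_add, Circle.exp_add,
    Circle.exp_neg, Circle.exp_neg, Circle.coe_mul, Circle.coe_inv, Circle.coe_inv, hexp,
    Circle.coe_exp Real.pi, exp_pi_mul_I]
  have hτ := (tan_half_pos h0 h1).ne'
  generalize Real.tan (α / 2) = τ at *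
  generalize Real.tan (t / 2) = u
  have h2 := hne (pow_ne_zero 2 hτ) u
  have h3 := hne one_ne_zero (-u)
  have h4 : (1 : ℂ) + τ ^ 2 ≠ 0 := by exact_mod_cast (by positivity : 1 + τ ^ 2 ≠ 0)
  have hτ0 : (τ : ℂ) ≠ 0 := ofReal_ne_zero.2 hτ
  push_cast at h2 h3 ⊢
  rw [neg_mul, ← sub_eq_add_neg] at h3
  have hnum : 1 - (1 - (τ : ℂ) ^ 2) / (1 + τ ^ 2) * ((1 + u * I) / (1 - u * I)) =
      2 * (τ ^ 2 - u * I) / ((1 + τ ^ 2) * (1 - u * I)) := by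
    field_simp
    ring
  have hden : (1 - (τ : ℂ) ^ 2) / (1 + τ ^ 2) - (1 + u * I) / (1 - u * I) =
      -2 * (τ ^ 2 + u * I) / ((1 + τ ^ 2) * (1 - u * I)) := by
    field_simp
    ring
  rw [hnum, hden]
  field_simp

theorem inversion_circleExp (h0 : 0 < α) (h1 : α < Real.pi / 2) (m : ℝ) {t : ℝ}
    (ht : t ∈ Icc (-α) α) {c : ℂ} (hc : c = Circle.exp m / Real.cos α) (hc1 : 1 < ‖c‖) :
    EuclideanGeometry.inversion c (orthRadius c) (Circle.exp (m + t) : ℂ) =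
      Circle.exp (m - reflectAngle α t) := by
  have hcos : (Real.cos α : ℂ) ≠ 0 :=
    ofReal_ne_zero.2 (Real.cos_pos_of_mem_Ioo ⟨by linarith, h1⟩).ne'
  have hne : (Circle.exp (m + t) : ℂ) ≠ c := by
    rintro rfl
    simp at hc1
  have hconj (u : Circle) : (starRingEnd ℂ) (u : ℂ) = (u : ℂ)⁻¹ := by
    rw [← Circle.coe_inv_eq_conj, Circle.coe_inv]
  have hm := (Circle.exp m).coe_ne_zero
  have ht0 := (Circle.exp t).coe_ne_zero
  rw [inversion_orthRadius hc1 hne, hc, map_div₀, conj_ofReal, hconj, hconj, sub_eq_add_neg m,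
    Circle.exp_add, Circle.exp_add, Circle.coe_mul, Circle.coe_mul,
    coe_circleExp_neg_reflectAngle h0 h1 ht]
  field_simp

end ReflectAngle

theorem exists_addConstMap_eqOn_Icc {a T b : ℝ} (hT : 0 < T) {g : ℝ → ℝ}
    (hg : ContinuousOn g (Icc a (a + T))) (hgT : g (a + T) = g a + b) :
    ∃ F : ℝ →+c[T, b] ℝ, Continuous F ∧ EqOn F g (Icc a (a + T)) := by
  have : Fact (0 < T) := ⟨hT⟩
  set g₀ : ℝ → ℝ := fun x => g x - b / T * x
  have hg₀ : g₀ a = g₀ (a + T) := by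
    simp only [g₀, hgT]
    field_simp
    ring
  set F : ℝ → ℝ := fun x => AddCircle.liftIco T a g₀ x + b / T * x
  have hF : Continuous F :=
    ((AddCircle.liftIco_continuous hg₀ (by fun_prop)).comp (AddCircle.continuous_mk' T)).add
      (by fun_prop)
  have hadd (x : ℝ) : F (x + T) = F x + b := by
    simp only [F, AddCircle.coe_add_period]
    field_simp
    ring
  have hIco : EqOn F g (Ico a (a + T)) := fun x hx => by
    simp only [F, AddCircle.liftIco_coe_apply hx, g₀, sub_add_cancel]
  refine ⟨⟨F, hadd⟩, hF, fun x hx => ?_⟩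
  rcases hx.2.lt_or_eq with hlt | rfl
  · exact hIco ⟨hx.1, hlt⟩
  · exact (hadd a).trans (by rw [hIco ⟨le_rfl, by linarith⟩, hgT])

theorem exists_baseLift {α : ℝ} (h0 : 0 < α) (h1 : α < Real.pi / 2) :
    ∃ F : ℝ →+c[2 * α, 2 * Real.pi - 2 * α] ℝ, Continuous F ∧
      (∀ t ∈ Icc (-α) α, F (t + α) = reflectAngle α t - α) ∧ StrictMono fun x => F x - x := by
  have hτ := (tan_half_pos h0 h1).ne'
  set g : ℝ → ℝ := fun x => reflectAngle α (x - α) - α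
  have hIcc {x : ℝ} (hx : x ∈ Icc 0 (0 + 2 * α)) : x - α ∈ Icc (-α) α :=
    ⟨by linarith [hx.1], by linarith [hx.2]⟩
  have hg : ContinuousOn g (Icc 0 (0 + 2 * α)) := fun x hx =>
    ((ContinuousAt.comp (f := fun x => x - α)
      (hasDerivAt_reflectAngle hτ (cos_half_pos h1 (hIcc hx)).ne').continuousAt
      (by fun_prop)).sub continuousAt_const).continuousWithinAt
  have hgT : g (0 + 2 * α) = g 0 + (2 * Real.pi - 2 * α) := by
    simp only [g, zero_sub, reflectAngle_left h0 h1]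
    rw [show 0 + 2 * α - α = α by ring, reflectAngle_right h0 h1]
    ring
  obtain ⟨F, hF, hFg⟩ := exists_addConstMap_eqOn_Icc (by linarith) hg hgT
  refine ⟨F, hF, fun t ht => ?_, ?_⟩
  · rw [hFg ⟨by linarith [ht.1], by linarith [ht.2]⟩]
    simp only [g, add_sub_cancel_right]
  · let G : ℝ →+c[2 * α, 2 * Real.pi - 2 * α - 2 * α] ℝ :=
      ⟨fun x => F x - x, fun x => by rw [AddConstMapClass.map_add_const]; ring⟩
    refine (AddConstMapClass.strictMono_iff_Icc (f := G) (by linarith) 0).2 fun x hx y hy hxy => ?_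
    have hlt := strictMonoOn_reflectAngle_sub_self h0 h1 (hIcc hx) (hIcc hy) (by linarith)
    change F x - x < F y - y
    rw [hFg hx, hFg hy]
    simp only [g] at hlt ⊢
    linarith

/-! ### Geometry of the base polygon -/

theorem coe_bdry (u : Circle) : (bdry u : ℂ) = u := rfl

theorem bdry_injective : Function.Injective bdry := fun _ _ huv =>
  Circle.ext (congrArg (fun z : Disk => (z : ℂ)) huv)

theorem exists_bdry_eq_of_norm_eq_one {z : Disk} (hz : ‖(z : ℂ)‖ = 1) : ∃ u, bdry u = z :=
  ⟨⟨z, mem_sphere_zero_iff_norm.2 hz⟩, rfl⟩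

/-- Half of the angle that a side of `Π` subtends at the origin. -/
def halfAngle (n p : ℕ) : ℝ := Real.pi / (n * p)

/-- The angle of the midpoint of the `k`-th arc. The sides of `Π` are numbered counter-clockwise, so
that `J_{r,s}` is the arc number `r * p + s`. -/
def midAngle (n p k : ℕ) : ℝ := (2 * k + 1) * halfAngle n p

/-- The angles of the points of the `k`-th arc without its counter-clockwise end. -/
def arcAngles (n p k : ℕ) : Set ℝ := Ico (2 * halfAngle n p * k) (2 * halfAngle n p * (k + 1))

/-- The `k`-th vertex of `Π`, at the clockwise end of the `k`-th arc. -/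
def vertex (n p k : ℕ) : Disk := bdry (Circle.exp (2 * halfAngle n p * k))

/-- A defining function of the `k`-th side of `Π`: it is negative on the open half-plane beyond this
side and vanishes on the side. -/
def sideFun (n p k : ℕ) (z : ℂ) : ℝ :=
  Real.cos (halfAngle n p) * (1 + ‖z‖ ^ 2) -
    2 * (z * (starRingEnd ℂ) (Circle.exp (midAngle n p k) : ℂ)).re

section

variable {n p : ℕ}

theorem natCast_left_ne_zero (h : 3 ≤ n * p) : (n : ℝ) ≠ 0 := by
  rintro h0
  simp [Nat.cast_eq_zero.1 h0] at h

theorem natCast_right_ne_zero (h : 3 ≤ n * p) : (p : ℝ) ≠ 0 := by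
  rintro h0
  simp [Nat.cast_eq_zero.1 h0] at h

theorem halfAngle_pos (h : 3 ≤ n * p) : 0 < halfAngle n p := by
  have h3 : (3 : ℝ) ≤ n * p := by exact_mod_cast h
  exact div_pos Real.pi_pos (by linarith)

theorem halfAngle_lt (h : 3 ≤ n * p) : halfAngle n p < Real.pi / 2 := by
  have h3 : (3 : ℝ) ≤ n * p := by exact_mod_cast h
  exact div_lt_div_of_pos_left Real.pi_pos (by norm_num) (by linarith)

theorem cos_halfAngle_pos (h : 3 ≤ n * p) : 0 < Real.cos (halfAngle n p) :=
  Real.cos_pos_of_mem_Ioo ⟨by linarith [halfAngle_pos h, Real.pi_pos], halfAngle_lt h⟩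

theorem halfAngle_mul (h : 3 ≤ n * p) : halfAngle n p * (n * p) = Real.pi := by
  have := natCast_left_ne_zero h
  have := natCast_right_ne_zero h
  rw [halfAngle]
  field_simp

theorem two_pi_div_eq (h : 3 ≤ n * p) : 2 * Real.pi / n = 2 * halfAngle n p * p := by
  have := natCast_left_ne_zero h
  rw [← halfAngle_mul h]
  field_simp

theorem two_pi_mul_div_eq (h : 3 ≤ n * p) (r s : ℝ) :
    2 * Real.pi * r / n + 2 * Real.pi * s / (n * p) = 2 * halfAngle n p * (r * p + s) := by
  have := natCast_left_ne_zero h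
  have := natCast_right_ne_zero h
  rw [halfAngle]
  field_simp

theorem center_eq (h : 3 ≤ n * p) (r : Fin n) (s : Fin p) :
    center n p r s = Circle.exp (midAngle n p (r * p + s)) / Real.cos (halfAngle n p) := by
  rw [center, two_pi_mul_div_eq h, midAngle, halfAngle]
  congr 3
  push_cast
  ring

theorem bdry_end_eq (h : 3 ≤ n * p) (r : Fin n) (s : Fin p) :
    bdry (Circle.exp (2 * Real.pi * r / n + 2 * Real.pi * (s + 1) / (n * p))) =
      vertex n p (r * p + s + 1) := by
  rw [two_pi_mul_div_eq h, vertex]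
  congr 2
  push_cast
  ring

theorem norm_center (h : 3 ≤ n * p) (r : Fin n) (s : Fin p) :
    ‖center n p r s‖ = 1 / Real.cos (halfAngle n p) := by
  rw [center_eq h, norm_div, Circle.norm_coe, Complex.norm_real,
    Real.norm_of_nonneg (cos_halfAngle_pos h).le]

theorem orthRadius_center_pos (h : 3 ≤ n * p) (r : Fin n) (s : Fin p) :
    0 < orthRadius (center n p r s) :=
  lt_of_le_of_ne (Real.sqrt_nonneg _) (orthRadius_ne (one_lt_norm_center h r s)).symm

theorem norm_sub_center_sq (h : 3 ≤ n * p) (r : Fin n) (s : Fin p) (z : ℂ) :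
    ‖z - center n p r s‖ ^ 2 = orthRadius (center n p r s) ^ 2 +
      sideFun n p (r * p + s) z / Real.cos (halfAngle n p) := by
  have hcos := (cos_halfAngle_pos h).ne'
  have hexpand : ‖z - center n p r s‖ ^ 2 =
      ‖z‖ ^ 2 + ‖center n p r s‖ ^ 2 - 2 * (z * (starRingEnd ℂ) (center n p r s)).re := by
    simp only [Complex.sq_norm, Complex.normSq_sub]
  rw [hexpand, orthRadius_sq (one_lt_norm_center h r s), sideFun]
  nth_rewrite 2 [center_eq h]
  rw [map_div₀, Complex.conj_ofReal, mul_div_assoc', Complex.div_ofReal_re]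
  field_simp
  ring

theorem norm_sub_center_le_iff (h : 3 ≤ n * p) (r : Fin n) (s : Fin p) (z : ℂ) :
    ‖z - center n p r s‖ ≤ orthRadius (center n p r s) ↔ sideFun n p (r * p + s) z ≤ 0 := by
  rw [← sq_le_sq₀ (norm_nonneg _) (orthRadius_center_pos h r s).le, norm_sub_center_sq h,
    add_le_iff_nonpos_right, div_le_iff₀ (cos_halfAngle_pos h), zero_mul]

theorem sideFun_polar (k : ℕ) (ρ t : ℝ) :
    sideFun n p k (ρ * Circle.exp (midAngle n p k + t)) =
      Real.cos (halfAngle n p) * (1 + ρ ^ 2) - 2 * (ρ * Real.cos t) := by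
  have hrot : (ρ * Circle.exp (midAngle n p k + t) : ℂ) *
      (starRingEnd ℂ) (Circle.exp (midAngle n p k) : ℂ) = ρ * Circle.exp t := by
    rw [← Circle.coe_inv_eq_conj, Circle.coe_inv, Circle.exp_add, Circle.coe_mul]
    field_simp [Circle.coe_ne_zero]
  rw [sideFun, hrot, norm_mul, Circle.norm_coe, mul_one, Complex.norm_real, Real.norm_eq_abs,
    sq_abs, Complex.re_ofReal_mul, Circle.coe_exp, Complex.exp_ofReal_mul_I_re]

theorem sideFun_circle (k : ℕ) (t : ℝ) :
    sideFun n p k (Circle.exp (midAngle n p k + t)) =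
      2 * (Real.cos (halfAngle n p) - Real.cos t) := by
  have hpolar := sideFun_polar (n := n) (p := p) k 1 t
  rw [ofReal_one, one_mul] at hpolar
  rw [hpolar]
  ring

theorem norm_pos_of_sideFun_nonpos (h : 3 ≤ n * p) {k : ℕ} {z : ℂ} (hz : sideFun n p k z ≤ 0) :
    0 < ‖z‖ := by
  rw [norm_pos_iff]
  rintro rfl
  have := cos_halfAngle_pos h
  norm_num [sideFun] at hz
  linarith

theorem exists_eq_norm_mul_circleExp (z : ℂ) (m : ℝ) :
    ∃ t, |t| ≤ Real.pi ∧ z = ‖z‖ * Circle.exp (m + t) := by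
  set v : ℂ := z * (starRingEnd ℂ) (Circle.exp m : ℂ) with hv
  have hnorm : ‖v‖ = ‖z‖ := by rw [hv, norm_mul, RCLike.norm_conj, Circle.norm_coe, mul_one]
  have hz : z = v * Circle.exp m := by
    rw [hv, mul_assoc, mul_comm ((starRingEnd ℂ) _), Complex.mul_conj, Circle.normSq_coe,
      ofReal_one, mul_one]
  refine ⟨arg v, Complex.abs_arg_le_pi v, ?_⟩
  conv_lhs => rw [hz, ← Complex.norm_mul_exp_arg_mul_I v, hnorm]
  rw [Circle.exp_add, Circle.coe_mul, Circle.coe_exp (arg v)]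
  ring

theorem exists_angle_of_sideFun_nonpos (h : 3 ≤ n * p) {k : ℕ} {z : ℂ}
    (hz : sideFun n p k z ≤ 0) :
    ∃ t, |t| ≤ halfAngle n p ∧ z = ‖z‖ * Circle.exp (midAngle n p k + t) ∧
      (|t| = halfAngle n p → ‖z‖ = 1) := by
  have hcos := cos_halfAngle_pos h
  have hpos := norm_pos_of_sideFun_nonpos h hz
  obtain ⟨t, ht, hzt⟩ := exists_eq_norm_mul_circleExp z (midAngle n p k)
  rw [hzt, sideFun_polar, ← Real.cos_abs t] at hz
  refine ⟨t, ?_, hzt, fun heq => ?_⟩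
  · by_contra! hlt
    have := Real.cos_lt_cos_of_nonneg_of_le_pi (halfAngle_pos h).le ht hlt
    nlinarith [sq_nonneg (‖z‖ - 1)]
  · rw [heq] at hz
    have hsq : (‖z‖ - 1) ^ 2 = 0 := le_antisymm (by nlinarith) (sq_nonneg _)
    exact sub_eq_zero.1 (pow_eq_zero_iff two_ne_zero |>.1 hsq)

theorem sideFun_vertex (k : ℕ) : sideFun n p k (vertex n p k) = 0 := by
  have hval := sideFun_circle (n := n) (p := p) k (-halfAngle n p)
  rw [Real.cos_neg, sub_self, mul_zero, midAngle] at hval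
  rw [vertex, coe_bdry, ← hval]
  congr 3
  ring

theorem sideFun_vertex_succ (k : ℕ) : sideFun n p k (vertex n p (k + 1)) = 0 := by
  have hval := sideFun_circle (n := n) (p := p) k (halfAngle n p)
  rw [sub_self, mul_zero, midAngle] at hval
  rw [vertex, coe_bdry, ← hval]
  congr 3
  push_cast
  ring

theorem norm_vertex (k : ℕ) : ‖(vertex n p k : ℂ)‖ = 1 := Circle.norm_coe _

theorem eq_vertex_of_sideFun_eq_zero (h : 3 ≤ n * p) {k : ℕ} {z : Disk} (hz : ‖(z : ℂ)‖ = 1)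
    (hk : sideFun n p k z = 0) : z = vertex n p k ∨ z = vertex n p (k + 1) := by
  obtain ⟨t, ht, hzt, -⟩ := exists_angle_of_sideFun_nonpos h hk.le
  rw [hz, ofReal_one, one_mul] at hzt
  rw [hzt, sideFun_circle, ← Real.cos_abs t] at hk
  have hpi := halfAngle_lt h
  have habs : |t| = halfAngle n p :=
    Real.injOn_cos ⟨abs_nonneg t, by linarith [Real.pi_pos]⟩
      ⟨(halfAngle_pos h).le, by linarith [Real.pi_pos]⟩ (by linarith)
  have hz' : z = bdry (Circle.exp (midAngle n p k + t)) := Subtype.ext hzt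
  rw [hz', midAngle, vertex, vertex]
  rcases (abs_eq (halfAngle_pos h).le).1 habs with rfl | rfl
  · right
    congr 2
    push_cast
    ring
  · left
    congr 2
    ring

theorem mem_halfPlane_iff (h : 3 ≤ n * p) (r : Fin n) (s : Fin p) (z : Disk) :
    z ∈ halfPlane n p r s ↔ sideFun n p (r * p + s) z ≤ 0 :=
  norm_sub_center_le_iff h r s z

theorem mem_piece_iff (h : 3 ≤ n * p) (r : Fin n) (s : Fin p) (z : Disk) :
    z ∈ piece n p r s ↔ sideFun n p (r * p + s) z ≤ 0 ∧ z ≠ vertex n p (r * p + s + 1) := by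
  rw [piece, Set.mem_sdiff, mem_halfPlane_iff h, mem_singleton_iff, bdry_end_eq h]

theorem mem_piece_of_norm_lt (h : 3 ≤ n * p) {r : Fin n} {s : Fin p} {z : Disk}
    (hz : sideFun n p (r * p + s) z ≤ 0) (hz1 : ‖(z : ℂ)‖ < 1) : z ∈ piece n p r s := by
  refine (mem_piece_iff h r s z).2 ⟨hz, ?_⟩
  rintro rfl
  exact hz1.ne (norm_vertex _)

theorem exists_angle_of_mem_piece (h : 3 ≤ n * p) {r : Fin n} {s : Fin p} {z : Disk}
    (hz : z ∈ piece n p r s) :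
    ∃ θ ∈ arcAngles n p (r * p + s), (z : ℂ) = ‖(z : ℂ)‖ * Circle.exp θ := by
  obtain ⟨hside, hvertex⟩ := (mem_piece_iff h r s z).1 hz
  obtain ⟨t, ht, hzt, hone⟩ := exists_angle_of_sideFun_nonpos h hside
  have hne : t ≠ halfAngle n p := by
    rintro rfl
    rw [hone (abs_of_pos (halfAngle_pos h)), ofReal_one, one_mul] at hzt
    apply hvertex
    ext
    rw [hzt, vertex, coe_bdry, midAngle]
    congr 2
    push_cast
    ring
  have hlt := lt_of_le_of_ne (abs_le.1 ht).2 hne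
  refine ⟨midAngle n p (r * p + s) + t, ⟨?_, ?_⟩, hzt⟩ <;> rw [midAngle] <;>
    linarith [(abs_le.1 ht).1]

theorem norm_pos_of_mem_piece (h : 3 ≤ n * p) {r : Fin n} {s : Fin p} {z : Disk}
    (hz : z ∈ piece n p r s) : 0 < ‖(z : ℂ)‖ :=
  norm_pos_of_sideFun_nonpos h ((mem_piece_iff h r s z).1 hz).1

theorem mem_arcAngles_iff (h : 3 ≤ n * p) {θ : ℝ} (hθ : 0 ≤ θ) (k : ℕ) :
    θ ∈ arcAngles n p k ↔ ⌊θ / (2 * halfAngle n p)⌋₊ = k := by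
  have hα : 0 < 2 * halfAngle n p := by linarith [halfAngle_pos h]
  rw [Nat.floor_eq_iff (div_nonneg hθ hα.le), le_div_iff₀' hα, div_lt_iff₀' hα]
  rfl

theorem arcAngles_subset_Ico (h : 3 ≤ n * p) {k : ℕ} (hk : k < n * p) :
    arcAngles n p k ⊆ Ico 0 (2 * Real.pi) := by
  have hα := halfAngle_pos h
  have hk' : (k : ℝ) + 1 ≤ n * p := by exact_mod_cast hk
  refine Ico_subset_Ico (by positivity) ?_
  rw [← halfAngle_mul h, ← mul_assoc]
  gcongr

theorem mul_add_lt (r : Fin n) (s : Fin p) : (r : ℕ) * p + s < n * p := by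
  have hlt := (finProdFinEquiv (r, s)).2
  rwa [finProdFinEquiv_apply_val, add_comm, mul_comm p] at hlt

theorem index_eq_of_mul_add_eq {r r' : Fin n} {s s' : Fin p}
    (heq : (r : ℕ) * p + s = r' * p + s') : r = r' ∧ s = s' := by
  refine Prod.mk.inj (finProdFinEquiv.injective (Fin.ext ?_))
  simpa only [finProdFinEquiv_apply_val, add_comm, mul_comm p] using heq

theorem exists_index_eq {k : ℕ} (hk : k < n * p) : ∃ (r : Fin n) (s : Fin p), r * p + s = k := by
  obtain ⟨⟨r, s⟩, hrs⟩ := finProdFinEquiv.surjective (⟨k, hk⟩ : Fin (n * p))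
  refine ⟨r, s, ?_⟩
  rw [add_comm, mul_comm, ← finProdFinEquiv_apply_val (r, s), hrs]

theorem index_eq_of_mem_piece (h : 3 ≤ n * p) {r r' : Fin n} {s s' : Fin p} {z : Disk}
    (hz : z ∈ piece n p r s) (hz' : z ∈ piece n p r' s') : r = r' ∧ s = s' := by
  obtain ⟨θ, hθ, hzθ⟩ := exists_angle_of_mem_piece h hz
  obtain ⟨θ', hθ', hzθ'⟩ := exists_angle_of_mem_piece h hz'
  have hθ0 := arcAngles_subset_Ico h (mul_add_lt r s) hθ
  have hθ0' := arcAngles_subset_Ico h (mul_add_lt r' s') hθ'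
  have hexp : (Circle.exp θ : ℂ) = Circle.exp θ' :=
    mul_left_cancel₀ (ofReal_ne_zero.2 (norm_pos_of_mem_piece h hz).ne') (hzθ.symm.trans hzθ')
  obtain rfl : θ = θ' :=
    Circle.exp_injOn_Ico (sub_zero _).le hθ0 hθ0' (Circle.ext hexp)
  exact index_eq_of_mul_add_eq
    (((mem_arcAngles_iff h hθ0.1 _).1 hθ).symm.trans ((mem_arcAngles_iff h hθ0.1 _).1 hθ'))

theorem bdry_mem_halfPlane (h : 3 ≤ n * p) {r : Fin n} {s : Fin p} {θ : ℝ}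
    (hθ : |θ - midAngle n p (r * p + s)| ≤ halfAngle n p) :
    bdry (Circle.exp θ) ∈ halfPlane n p r s := by
  have hval := sideFun_circle (n := n) (p := p) (r * p + s) (θ - midAngle n p (r * p + s))
  rw [add_sub_cancel, ← Real.cos_abs (θ - _)] at hval
  rw [mem_halfPlane_iff h, coe_bdry, hval]
  linarith [Real.cos_le_cos_of_nonneg_of_le_pi (abs_nonneg _)
    (by linarith [halfAngle_lt h, Real.pi_pos]) hθ]

theorem abs_sub_midAngle_le {k : ℕ} {θ : ℝ}
    (hθ : θ ∈ Icc (2 * halfAngle n p * k) (2 * halfAngle n p * (k + 1))) :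
    |θ - midAngle n p k| ≤ halfAngle n p := by
  rw [abs_le, midAngle]
  constructor <;> linarith [hθ.1, hθ.2]

theorem bdry_circleExp_eq_vertex_iff (h : 3 ≤ n * p) {θ : ℝ} {k j : ℕ}
    (hθ : θ ∈ Icc (2 * halfAngle n p * k) (2 * halfAngle n p * (k + 1)))
    (hj : (j : ℝ) ∈ Icc (k : ℝ) (k + 1)) :
    bdry (Circle.exp θ) = vertex n p j ↔ θ = 2 * halfAngle n p * j := by
  have hα : 0 < 2 * halfAngle n p := by linarith [halfAngle_pos h]
  refine bdry_injective.eq_iff.trans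
    ((Circle.exp_injOn_Icc ?_).eq_iff hθ ⟨?_, ?_⟩)
  · linarith [halfAngle_lt h]
  · exact mul_le_mul_of_nonneg_left hj.1 hα.le
  · exact mul_le_mul_of_nonneg_left hj.2 hα.le

theorem vertex_ne_vertex_succ (h : 3 ≤ n * p) (k : ℕ) : vertex n p k ≠ vertex n p (k + 1) := by
  have hα := halfAngle_pos h
  rw [vertex, Ne, bdry_circleExp_eq_vertex_iff h (k := k) ⟨le_rfl, by linarith⟩ (by simp)]
  push_cast
  linarith

theorem bdry_mem_piece (h : 3 ≤ n * p) {r : Fin n} {s : Fin p} {θ : ℝ}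
    (hθ : θ ∈ arcAngles n p (r * p + s)) : bdry (Circle.exp θ) ∈ piece n p r s := by
  have hθ' := Ico_subset_Icc_self hθ
  refine (mem_piece_iff h r s _).2
    ⟨(mem_halfPlane_iff h r s _).1 (bdry_mem_halfPlane h (abs_sub_midAngle_le hθ')), ?_⟩
  rw [Ne, bdry_circleExp_eq_vertex_iff h hθ' (by simp)]
  exact_mod_cast hθ.2.ne

theorem exists_mem_piece_of_norm_eq_one (h : 3 ≤ n * p) {z : Disk} (hz : ‖(z : ℂ)‖ = 1) :
    ∃ r s, z ∈ piece n p r s := by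
  obtain ⟨u, rfl⟩ := exists_bdry_eq_of_norm_eq_one hz
  obtain ⟨θ₀, rfl⟩ := Circle.exp_surjective u
  obtain ⟨θ, hθ, hθ₀⟩ := Circle.periodic_exp.exists_mem_Ico₀ Real.two_pi_pos θ₀
  have hα : 0 < 2 * halfAngle n p := by linarith [halfAngle_pos h]
  have hlt : ⌊θ / (2 * halfAngle n p)⌋₊ < n * p := by
    rw [Nat.floor_lt (div_nonneg hθ.1 hα.le), div_lt_iff₀' hα]
    push_cast
    linarith [halfAngle_mul h, hθ.2]
  obtain ⟨r, s, hrs⟩ := exists_index_eq hlt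
  rw [hθ₀]
  exact ⟨r, s, bdry_mem_piece h ((mem_arcAngles_iff h hθ.1 _).2 hrs.symm)⟩

theorem exists_mem_piece_of_mem_halfPlane (h : 3 ≤ n * p) {r : Fin n} {s : Fin p} {z : Disk}
    (hz : z ∈ halfPlane n p r s) : ∃ r s, z ∈ piece n p r s := by
  rcases z.norm_le.lt_or_eq with hlt | heq
  · exact ⟨r, s, mem_piece_of_norm_lt h ((mem_halfPlane_iff h r s z).1 hz) hlt⟩
  · exact exists_mem_piece_of_norm_eq_one h heq

theorem polygon_eq :
    polygon n p = Metric.ball 0 1 ∩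
      ⋂ r, ⋂ s, (Metric.ball (center n p r s) (orthRadius (center n p r s)))ᶜ := by
  ext z
  simp [polygon, dist_eq_norm]

theorem mem_interior_polygon_iff (h : 3 ≤ n * p) (z : ℂ) :
    z ∈ interior (polygon n p) ↔
      ‖z‖ < 1 ∧ ∀ (r : Fin n) (s : Fin p), 0 < sideFun n p (r * p + s) z := by
  simp only [polygon_eq, interior_inter, Metric.isOpen_ball.interior_eq, interior_iInter_of_finite,
    interior_compl, closure_ball _ (orthRadius_center_pos h _ _).ne', mem_inter_iff,
    mem_ball_zero_iff, mem_iInter, mem_compl_iff, Metric.mem_closedBall, dist_eq_norm,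
    norm_sub_center_le_iff h, not_le]

theorem mem_baseDomain_iff (h : 3 ≤ n * p) (z : Disk) :
    z ∈ baseDomain n p ↔ ∃ r s, z ∈ piece n p r s := by
  change ¬ (z : ℂ) ∈ interior (polygon n p) ↔ _
  rw [mem_interior_polygon_iff h]
  constructor
  · intro hz
    rcases z.norm_le.lt_or_eq with hlt | heq
    · push Not at hz
      obtain ⟨r, s, hrs⟩ := hz hlt
      exact ⟨r, s, mem_piece_of_norm_lt h hrs hlt⟩
    · exact exists_mem_piece_of_norm_eq_one h heq
  · rintro ⟨r, s, hz⟩ hint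
    exact (hint.2 r s).not_ge ((mem_piece_iff h r s z).1 hz).1

theorem sideFun_real_mul_pos (h : 3 ≤ n * p) {k : ℕ} {z : ℂ} (hz1 : ‖z‖ < 1)
    (hz : 0 ≤ sideFun n p k z) {t : ℝ} (ht : t ∈ Ioo 0 1) : 0 < sideFun n p k (t * z) := by
  have hcos := cos_halfAngle_pos h
  have hlt : t * ‖z‖ ^ 2 < 1 := by nlinarith [ht.1, ht.2, norm_nonneg z]
  have heq : sideFun n p k (t * z) =
      t * sideFun n p k z + Real.cos (halfAngle n p) * ((1 - t) * (1 - t * ‖z‖ ^ 2)) := by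
    rw [sideFun, sideFun, norm_mul, Complex.norm_real, mul_assoc, Complex.re_ofReal_mul, mul_pow,
      Real.norm_eq_abs, sq_abs]
    ring
  rw [heq]
  exact add_pos_of_nonneg_of_pos (mul_nonneg ht.1.le hz)
    (mul_pos hcos (mul_pos (sub_pos.2 ht.2) (sub_pos.2 hlt)))

theorem real_mul_mem_interior_polygon (h : 3 ≤ n * p) {r : Fin n} {s : Fin p} {z : Disk}
    (hz1 : ‖(z : ℂ)‖ < 1) (hz : sideFun n p (r * p + s) z = 0) {t : ℝ} (ht : t ∈ Ioo 0 1) :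
    (t * z : ℂ) ∈ interior (polygon n p) := by
  refine (mem_interior_polygon_iff h _).2 ⟨?_, fun r' s' => sideFun_real_mul_pos h hz1 ?_ ht⟩
  · rw [norm_mul, Complex.norm_real, Real.norm_of_nonneg ht.1.le]
    nlinarith [ht.1, ht.2, norm_nonneg (z : ℂ)]
  by_contra! hneg
  obtain ⟨rfl, rfl⟩ := index_eq_of_mem_piece h (mem_piece_of_norm_lt h hz.le hz1)
    (mem_piece_of_norm_lt h hneg.le hz1)
  exact hneg.ne hz

theorem coe_rot_pow (u : Circle) (j : ℕ) (z : Disk) :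
    (((rot u ^ j) z : Disk) : ℂ) = (u : ℂ) ^ j * z := by
  induction j with
  | zero => simp
  | succ j ih =>
    rw [pow_succ', pow_succ', Homeomorph.mul_apply, mul_assoc, ← ih]
    rfl

theorem norm_rot_pow (u : Circle) (j : ℕ) (z : Disk) :
    ‖(((rot u ^ j) z : Disk) : ℂ)‖ = ‖(z : ℂ)‖ := by
  rw [coe_rot_pow, norm_mul, norm_pow, Circle.norm_coe, one_pow, one_mul]

theorem omega_pow (n : ℕ) : omega n ^ n = 1 := by
  rcases eq_or_ne n 0 with rfl | hn
  · exact pow_zero _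
  · rw [omega, ← Circle.exp_natCast_mul, mul_div_cancel₀ _ (Nat.cast_ne_zero.2 hn),
      Circle.exp_two_pi]

theorem omega_pow_eq (h : 3 ≤ n * p) (r : ℕ) :
    omega n ^ r = Circle.exp (2 * halfAngle n p * (r * p : ℕ)) := by
  rw [omega, two_pi_div_eq h, ← Circle.exp_natCast_mul]
  congr 1
  push_cast
  ring

theorem rot_omega_pow (n : ℕ) : rot (omega n) ^ n = 1 := by
  ext z
  rw [coe_rot_pow, ← Circle.coe_pow, omega_pow, Circle.coe_one, one_mul, Homeomorph.one_apply]

theorem rot_omega_pow_mod (j : ℕ) : rot (omega n) ^ j = rot (omega n) ^ (j % n) :=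
  pow_eq_pow_mod j (rot_omega_pow n)

theorem rot_pow_vertex (h : 3 ≤ n * p) (r k : ℕ) :
    (rot (omega n) ^ r) (vertex n p k) = vertex n p (r * p + k) := by
  ext
  rw [coe_rot_pow, ← Circle.coe_pow, omega_pow_eq h, vertex, vertex, coe_bdry, coe_bdry,
    ← Circle.coe_mul, ← Circle.exp_add]
  congr 2
  push_cast
  ring

theorem sideFun_rot_pow (h : 3 ≤ n * p) (r k : ℕ) (z : Disk) :
    sideFun n p (r * p + k) ((rot (omega n) ^ r) z : Disk) = sideFun n p k z := by
  have hmid : Circle.exp (midAngle n p (r * p + k)) =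
      omega n ^ r * Circle.exp (midAngle n p k) := by
    rw [omega_pow_eq h, ← Circle.exp_add, midAngle, midAngle]
    congr 1
    push_cast
    ring
  have hunit : (omega n : ℂ) ^ r * (starRingEnd ℂ) ((omega n : ℂ) ^ r) = 1 := by
    rw [← Circle.coe_pow, Complex.mul_conj, Circle.normSq_coe, ofReal_one]
  rw [sideFun, norm_rot_pow, coe_rot_pow, hmid, Circle.coe_mul, Circle.coe_pow, map_mul,
    mul_mul_mul_comm, hunit, one_mul, sideFun]

/-- The index of the first sector. -/
abbrev zeroIndex (h : 3 ≤ n * p) : Fin n := ⟨0, pos_of_three_le h⟩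

theorem mem_piece_zeroIndex_iff (h : 3 ≤ n * p) (s : Fin p) (z : Disk) :
    z ∈ piece n p (zeroIndex h) s ↔ sideFun n p s z ≤ 0 ∧ z ≠ vertex n p (s + 1) := by
  simp only [mem_piece_iff h, zero_mul, zero_add]

theorem rot_pow_mem_piece_iff (h : 3 ≤ n * p) (r : Fin n) (s : Fin p) (z : Disk) :
    (rot (omega n) ^ (r : ℕ)) z ∈ piece n p r s ↔ z ∈ piece n p (zeroIndex h) s := by
  rw [mem_piece_iff h, sideFun_rot_pow h, add_assoc, ← rot_pow_vertex h,
    (rot (omega n) ^ (r : ℕ)).injective.ne_iff, mem_piece_zeroIndex_iff h]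

end

/-! ### The side pairings -/

theorem norm_inversion_orthRadius_eq_one {c z : ℂ} (hc : 1 < ‖c‖) (hz : ‖z‖ = 1) :
    ‖EuclideanGeometry.inversion c (orthRadius c) z‖ = 1 := by
  have hne : z ≠ c := by
    rintro rfl
    exact hc.ne' hz
  have hunit : z * (starRingEnd ℂ) z = 1 := by
    rw [Complex.mul_conj, Complex.normSq_eq_norm_sq, hz, one_pow, ofReal_one]
  have hnum : c * (starRingEnd ℂ) z - 1 = (c - z) * (starRingEnd ℂ) z := by rw [sub_mul, hunit]
  rw [inversion_orthRadius hc hne, hnum, ← map_sub, norm_div, norm_mul, RCLike.norm_conj,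
    RCLike.norm_conj, hz, mul_one, norm_sub_rev,
    div_self (norm_ne_zero_iff.2 (sub_ne_zero.2 hne))]

section

variable {n p : ℕ}

theorem coe_pairingOne (h : 3 ≤ n * p) (s : Fin p) (z : Disk) :
    (pairingOne h s z : ℂ) = (omega n : ℂ) * (starRingEnd ℂ)
      (EuclideanGeometry.inversion (center n p (zeroIndex h) s)
        (orthRadius (center n p (zeroIndex h) s)) (z : ℂ)) := rfl

theorem center_zeroIndex (h : 3 ≤ n * p) (s : Fin p) :
    center n p (zeroIndex h) s =
      Circle.exp (midAngle n p s) / Real.cos (halfAngle n p) := by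
  rw [center_eq h, zero_mul, zero_add]

theorem center_rev (h : 3 ≤ n * p) (s : Fin p) :
    center n p (zeroIndex h) s.rev =
      (omega n : ℂ) * (starRingEnd ℂ) (center n p (zeroIndex h) s) := by
  have hrev : ((s.rev : ℕ) : ℝ) = p - (s + 1) := by
    rw [Fin.val_rev, Nat.cast_sub s.2]
    push_cast
    ring
  rw [center_zeroIndex, center_zeroIndex, map_div₀, Complex.conj_ofReal,
    ← Circle.coe_inv_eq_conj, ← Circle.exp_neg, omega, two_pi_div_eq h, mul_div_assoc',
    ← Circle.coe_mul, ← Circle.exp_add, midAngle, midAngle, hrev]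
  congr 3
  ring

theorem norm_pairingOne_sub_mul (h : 3 ≤ n * p) (s : Fin p) (z : Disk) :
    ‖(pairingOne h s z : ℂ) - center n p (zeroIndex h) s.rev‖ *
      ‖(z : ℂ) - center n p (zeroIndex h) s‖ = orthRadius (center n p (zeroIndex h) s) ^ 2 := by
  have hne := Disk.ne_center (one_lt_norm_center h (zeroIndex h) s) z
  rw [coe_pairingOne, center_rev h s, ← mul_sub, ← map_sub, norm_mul, Circle.norm_coe, one_mul,
    RCLike.norm_conj, ← dist_eq_norm, EuclideanGeometry.dist_inversion_center, dist_eq_norm,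
    div_mul_cancel₀ _ (norm_ne_zero_iff.2 (sub_ne_zero.2 hne))]

theorem sideFun_pairingOne_mul (h : 3 ≤ n * p) (s : Fin p) (z : Disk) :
    sideFun n p s.rev (pairingOne h s z) * ‖(z : ℂ) - center n p (zeroIndex h) s‖ ^ 2 =
      -orthRadius (center n p (zeroIndex h) s) ^ 2 * sideFun n p s z := by
  have hcos := (cos_halfAngle_pos h).ne'
  have hmul := congrArg (· ^ 2) (norm_pairingOne_sub_mul h s z)
  have hradius : orthRadius (center n p (zeroIndex h) s.rev) =
      orthRadius (center n p (zeroIndex h) s) := by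
    rw [orthRadius, orthRadius, norm_center h, norm_center h]
  simp only [mul_pow, norm_sub_center_sq h, hradius, zero_mul, zero_add] at hmul
  rw [norm_sub_center_sq h, zero_mul, zero_add]
  field_simp at hmul ⊢
  linear_combination hmul

theorem sign_sideFun_pairingOne (h : 3 ≤ n * p) (s : Fin p) (z : Disk) :
    SignType.sign (sideFun n p s.rev (pairingOne h s z)) =
      -SignType.sign (sideFun n p s z) := by
  have hsign := congrArg SignType.sign (sideFun_pairingOne_mul h s z)
  have hcenter : 0 < ‖(z : ℂ) - center n p (zeroIndex h) s‖ :=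
    norm_pos_iff.2 (sub_ne_zero.2 (Disk.ne_center (one_lt_norm_center h _ s) z))
  rwa [neg_mul, Left.sign_neg, sign_mul, sign_mul, sign_pos (pow_pos hcenter 2),
    sign_pos (pow_pos (orthRadius_center_pos h _ s) 2), mul_one, one_mul] at hsign

theorem sideFun_pairingOne_pos_iff (h : 3 ≤ n * p) (s : Fin p) (z : Disk) :
    0 < sideFun n p s.rev (pairingOne h s z) ↔ sideFun n p s z < 0 := by
  rw [← sign_eq_one_iff, sign_sideFun_pairingOne, neg_eq_iff_eq_neg, sign_eq_neg_one_iff]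

theorem sideFun_pairingOne_eq_zero_iff (h : 3 ≤ n * p) (s : Fin p) (z : Disk) :
    sideFun n p s.rev (pairingOne h s z) = 0 ↔ sideFun n p s z = 0 := by
  rw [← sign_eq_zero_iff, sign_sideFun_pairingOne, neg_eq_iff_eq_neg, neg_zero, sign_eq_zero_iff]

theorem norm_pairingOne_eq_one_iff (h : 3 ≤ n * p) (s : Fin p) (z : Disk) :
    ‖(pairingOne h s z : ℂ)‖ = 1 ↔ ‖(z : ℂ)‖ = 1 := by
  have hc := one_lt_norm_center h (zeroIndex h) s
  rw [coe_pairingOne, norm_mul, Circle.norm_coe, one_mul, RCLike.norm_conj]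
  refine ⟨fun hz => ?_, norm_inversion_orthRadius_eq_one hc⟩
  rw [← EuclideanGeometry.inversion_inversion _ (orthRadius_ne hc) (z : ℂ)]
  exact norm_inversion_orthRadius_eq_one hc hz

theorem norm_pairingOne_lt_one_iff (h : 3 ≤ n * p) (s : Fin p) (z : Disk) :
    ‖(pairingOne h s z : ℂ)‖ < 1 ↔ ‖(z : ℂ)‖ < 1 := by
  rw [(pairingOne h s z).norm_le.lt_iff_ne, z.norm_le.lt_iff_ne, Ne, Ne,
    norm_pairingOne_eq_one_iff]

/-- A lift to the real line, along `x ↦ exp (ix)`, of the Bowen-Series map of the base group modulo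
the powers of `ω`. -/
def baseLift (h : 3 ≤ n * p) : ℝ →+c[2 * halfAngle n p, 2 * Real.pi - 2 * halfAngle n p] ℝ :=
  (exists_baseLift (halfAngle_pos h) (halfAngle_lt h)).choose

theorem continuous_baseLift (h : 3 ≤ n * p) : Continuous (baseLift h) :=
  (exists_baseLift (halfAngle_pos h) (halfAngle_lt h)).choose_spec.1

theorem baseLift_add_halfAngle (h : 3 ≤ n * p) {t : ℝ}
    (ht : t ∈ Icc (-halfAngle n p) (halfAngle n p)) :
    baseLift h (t + halfAngle n p) = reflectAngle (halfAngle n p) t - halfAngle n p :=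
  (exists_baseLift (halfAngle_pos h) (halfAngle_lt h)).choose_spec.2.1 t ht

theorem strictMono_baseLift_sub_self (h : 3 ≤ n * p) : StrictMono fun x => baseLift h x - x :=
  (exists_baseLift (halfAngle_pos h) (halfAngle_lt h)).choose_spec.2.2

theorem baseLift_zero (h : 3 ≤ n * p) : baseLift h 0 = 0 := by
  have hα := halfAngle_pos h
  have hleft := baseLift_add_halfAngle h (t := -halfAngle n p) ⟨le_rfl, by linarith⟩
  rwa [neg_add_cancel, reflectAngle_left hα (halfAngle_lt h), sub_self] at hleft

theorem baseLift_eq (h : 3 ≤ n * p) {k : ℕ} {θ : ℝ} (hθ : |θ - midAngle n p k| ≤ halfAngle n p) :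
    baseLift h θ = reflectAngle (halfAngle n p) (θ - midAngle n p k) - halfAngle n p +
      k * (2 * Real.pi - 2 * halfAngle n p) := by
  rw [← baseLift_add_halfAngle h (abs_le.1 hθ), ← nsmul_eq_mul, ← AddConstMapClass.map_add_nsmul]
  congr 1
  rw [midAngle, nsmul_eq_mul]
  ring

theorem pairingOne_bdry (h : 3 ≤ n * p) (s : Fin p) {θ : ℝ}
    (hθ : |θ - midAngle n p s| ≤ halfAngle n p) :
    pairingOne h s (bdry (Circle.exp θ)) = bdry (omega n * Circle.exp (baseLift h θ)) := by
  have hinv := inversion_circleExp (halfAngle_pos h) (halfAngle_lt h) (midAngle n p s)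
    (abs_le.1 hθ) (center_zeroIndex h s) (one_lt_norm_center h _ s)
  rw [add_sub_cancel] at hinv
  ext
  rw [coe_pairingOne, coe_bdry, coe_bdry, hinv, ← Circle.coe_inv_eq_conj, ← Circle.exp_neg,
    ← Circle.coe_mul, baseLift_eq h hθ, omega, ← Circle.exp_add, ← Circle.exp_add]
  congr 1
  refine Circle.exp_eq_exp.2 ⟨-s, ?_⟩
  rw [midAngle]
  push_cast
  ring

theorem pairingOne_vertex (h : 3 ≤ n * p) (s : Fin p) :
    pairingOne h s (vertex n p s) = vertex n p (s.rev + 1) := by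
  have hα := halfAngle_pos h
  have hθ : |2 * halfAngle n p * (s : ℕ) - midAngle n p s| ≤ halfAngle n p :=
    abs_sub_midAngle_le ⟨le_rfl, by linarith⟩
  have hlift : baseLift h (2 * halfAngle n p * (s : ℕ)) =
      (s : ℕ) * (2 * Real.pi - 2 * halfAngle n p) := by
    have hadd := AddConstMapClass.map_add_nsmul (baseLift h) 0 (s : ℕ)
    rwa [zero_add, baseLift_zero, zero_add, nsmul_eq_mul, nsmul_eq_mul,
      mul_comm _ (2 * halfAngle n p)] at hadd
  have hrev : ((s.rev + 1 : ℕ) : ℝ) = p - s := by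
    rw [Fin.val_rev, ← Nat.cast_sub s.2.le]
    congr 1
    omega
  rw [vertex, pairingOne_bdry h s hθ, vertex, hlift, omega, ← Circle.exp_add, two_pi_div_eq h,
    hrev]
  congr 1
  refine Circle.exp_eq_exp.2 ⟨s, ?_⟩
  push_cast
  ring

/-- Here the choice of the piece that contains a vertex matters: `g_{1,s}` maps the vertex in the
`s`-th piece to the vertex missing from the paired one. -/
theorem pairingOne_notMem_piece_iff (h : 3 ≤ n * p) (s : Fin p) (z : Disk) :
    pairingOne h s z ∉ piece n p (zeroIndex h) s.rev ↔
      z ∈ piece n p (zeroIndex h) s ∧ ¬ (‖(z : ℂ)‖ < 1 ∧ sideFun n p s z = 0) := by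
  rw [mem_piece_zeroIndex_iff, mem_piece_zeroIndex_iff, not_and_or, not_le, not_not,
    sideFun_pairingOne_pos_iff, ← pairingOne_vertex h s, (pairingOne h s).injective.eq_iff]
  constructor
  · rintro (hlt | rfl)
    · refine ⟨⟨hlt.le, ?_⟩, fun hside => hlt.ne hside.2⟩
      rintro rfl
      exact hlt.ne (sideFun_vertex_succ _)
    · exact ⟨⟨(sideFun_vertex _).le, vertex_ne_vertex_succ h _⟩,
        fun hside => hside.1.ne (norm_vertex _)⟩
  · rintro ⟨⟨hle, hne⟩, hside⟩
    refine hle.lt_or_eq.imp_right fun heq => ?_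
    have hz1 : ‖(z : ℂ)‖ = 1 := by
      by_contra hz1
      exact hside ⟨lt_of_le_of_ne z.norm_le hz1, heq⟩
    exact (eq_vertex_of_sideFun_eq_zero h hz1 heq).resolve_right hne

/-! ### The Bowen-Series map of the base group -/

theorem baseBowenSeries_eq (h : 3 ≤ n * p) {r : Fin n} {s : Fin p} {z : Disk}
    (hz : z ∈ piece n p r s) : baseBowenSeries h z = pairing h r s z := by
  have hex : ∃ i : Fin n × Fin p, z ∈ piece n p i.1 i.2 := ⟨(r, s), hz⟩
  obtain ⟨hr, hs⟩ := index_eq_of_mem_piece h hz hex.choose_spec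
  rw [baseBowenSeries, dif_pos hex, ← hr, ← hs]

theorem exists_rot_pow_mem_piece (h : 3 ≤ n * p) {s : Fin p} {y : Disk}
    (hy : y ∈ piece n p (zeroIndex h) s) (j : ℕ) :
    ∃ r : Fin n, (r : ℕ) = j % n ∧ (rot (omega n) ^ j) y ∈ piece n p r s := by
  refine ⟨⟨j % n, Nat.mod_lt _ (pos_of_three_le h)⟩, rfl, ?_⟩
  rw [rot_omega_pow_mod]
  exact (rot_pow_mem_piece_iff h ⟨j % n, _⟩ s y).2 hy

theorem baseBowenSeries_rot_pow (h : 3 ≤ n * p) {s : Fin p} {y : Disk}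
    (hy : y ∈ piece n p (zeroIndex h) s) (j : ℕ) :
    baseBowenSeries h ((rot (omega n) ^ j) y) = (rot (omega n) ^ j) (pairingOne h s y) := by
  obtain ⟨r, hr, hmem⟩ := exists_rot_pow_mem_piece h hy j
  rw [baseBowenSeries_eq h hmem, pairing, rot_omega_pow_mod j, ← hr,
    ← Homeomorph.mul_apply, inv_mul_cancel_right, Homeomorph.mul_apply]

theorem exists_eq_rot_pow_of_mem_baseDomain (h : 3 ≤ n * p) {z : Disk}
    (hz : z ∈ baseDomain n p) :
    ∃ (j : ℕ) (s : Fin p), ∃ y ∈ piece n p (zeroIndex h) s, z = (rot (omega n) ^ j) y := by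
  obtain ⟨r, s, hrs⟩ := (mem_baseDomain_iff h z).1 hz
  obtain ⟨y, rfl⟩ := (rot (omega n) ^ (r : ℕ)).surjective z
  exact ⟨r, s, y, (rot_pow_mem_piece_iff h r s y).1 hrs, rfl⟩

theorem rot_pow_mem_baseDomain (h : 3 ≤ n * p) {z : Disk} (hz : z ∈ baseDomain n p) (j : ℕ) :
    (rot (omega n) ^ j) z ∈ baseDomain n p := by
  obtain ⟨i, s, y, hy, rfl⟩ := exists_eq_rot_pow_of_mem_baseDomain h hz
  rw [← Homeomorph.mul_apply, ← pow_add]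
  obtain ⟨r, -, hr⟩ := exists_rot_pow_mem_piece h hy (j + i)
  exact (mem_baseDomain_iff h _).2 ⟨r, s, hr⟩

theorem eq_of_rot_pow_mem_piece (h : 3 ≤ n * p) {s s' : Fin p} {y : Disk} {j : ℕ}
    (hy : y ∈ piece n p (zeroIndex h) s)
    (hy' : (rot (omega n) ^ j) y ∈ piece n p (zeroIndex h) s') :
    s = s' ∧ (rot (omega n) ^ j) y = y := by
  obtain ⟨r, hr, hmem⟩ := exists_rot_pow_mem_piece h hy j
  obtain ⟨hr0, hs⟩ := index_eq_of_mem_piece h hmem hy'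
  rw [hr0] at hr
  refine ⟨hs, ?_⟩
  rw [rot_omega_pow_mod, ← hr, pow_zero, Homeomorph.one_apply]

end

/-! ### The factor map and its domain -/

theorem coe_omega (n : ℕ) : (omega n : ℂ) = Complex.exp (2 * Real.pi * I / n) := by
  rw [omega, Circle.coe_exp]
  push_cast
  ring_nf

theorem isPrimitiveRoot_omega {n : ℕ} (hn : n ≠ 0) : IsPrimitiveRoot (omega n : ℂ) n := by
  rw [coe_omega]
  exact Complex.isPrimitiveRoot_exp n hn

/-- The quotient map of the disk by the rotation of order `n`, after `ψ`: the factor Bowen-Series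
map is the quotient by `quo n ψ` of the Bowen-Series map of the base group. -/
def quo (n : ℕ) (ψ : Disk ≃ₜ Disk) (z : Disk) : ℂ := (ψ z : ℂ) ^ n

/-- The homeomorphisms of the closed disk that preserve the open disk and descend to the quotient
by the rotation `M_ω`. The topology of the factor Bowen-Series map only depends on this part of
`InducesTeichOmega`. -/
structure IsOmegaEquivariant (n : ℕ) (ψ : Disk ≃ₜ Disk) : Prop where
  norm_lt_one_iff : ∀ z : Disk, ‖(ψ z : ℂ)‖ < 1 ↔ ‖(z : ℂ)‖ < 1
  map_omega : ∀ z, ψ (rot (omega n) z) = rot (omega n) (ψ z)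

section

variable {n p : ℕ} {ψ : Disk ≃ₜ Disk}

theorem continuous_quo : Continuous (quo n ψ) := by
  unfold quo
  fun_prop

theorem norm_quo_le (z : Disk) : ‖quo n ψ z‖ ≤ 1 := by
  rw [quo, norm_pow]
  exact pow_le_one₀ (norm_nonneg _) (ψ z).norm_le

theorem exists_quo_eq (hn : n ≠ 0) {w : ℂ} (hw : ‖w‖ ≤ 1) : ∃ z, quo n ψ z = w := by
  obtain ⟨x, rfl⟩ := IsAlgClosed.exists_pow_nat_eq w (Nat.pos_of_ne_zero hn)
  rw [norm_pow, pow_le_one_iff_of_nonneg (norm_nonneg _) hn] at hw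
  exact ⟨ψ.symm ⟨x, mem_closedBall_zero_iff.2 hw⟩, by rw [quo, ψ.apply_symm_apply]⟩

theorem factorDomain_eq_image : factorDomain n p ψ = quo n ψ '' baseDomain n p := by
  rw [factorDomain, bowenSeriesDomain, image_image]
  rfl

theorem factorDomain_subset : factorDomain n p ψ ⊆ Metric.closedBall 0 1 := by
  rw [factorDomain_eq_image]
  rintro _ ⟨z, -, rfl⟩
  exact mem_closedBall_zero_iff.2 (norm_quo_le z)

theorem isClosed_halfPlane (r : Fin n) (s : Fin p) : IsClosed (halfPlane n p r s) :=
  isClosed_le (by fun_prop) continuous_const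

namespace IsOmegaEquivariant

theorem norm_quo_lt_one_iff (hψ : IsOmegaEquivariant n ψ) (hn : n ≠ 0) (z : Disk) :
    ‖quo n ψ z‖ < 1 ↔ ‖(z : ℂ)‖ < 1 := by
  rw [quo, norm_pow, pow_lt_one_iff_of_nonneg (norm_nonneg _) hn, hψ.norm_lt_one_iff]

theorem norm_quo_eq_one_iff (hψ : IsOmegaEquivariant n ψ) (hn : n ≠ 0) (z : Disk) :
    ‖quo n ψ z‖ = 1 ↔ ‖(z : ℂ)‖ = 1 := by
  rw [← (norm_quo_le z).not_lt_iff_eq, ← z.norm_le.not_lt_iff_eq, hψ.norm_quo_lt_one_iff hn]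

theorem map_rot_pow (hψ : IsOmegaEquivariant n ψ) (j : ℕ) (z : Disk) :
    ψ ((rot (omega n) ^ j) z) = (rot (omega n) ^ j) (ψ z) := by
  induction j with
  | zero => simp
  | succ j ih =>
    rw [pow_succ', Homeomorph.mul_apply, Homeomorph.mul_apply, hψ.map_omega, ih]

theorem quo_rot_pow (hψ : IsOmegaEquivariant n ψ) (j : ℕ) (z : Disk) :
    quo n ψ ((rot (omega n) ^ j) z) = quo n ψ z := by
  rw [quo, quo, hψ.map_rot_pow, coe_rot_pow, mul_pow, pow_right_comm, ← Circle.coe_pow,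
    omega_pow, Circle.coe_one, one_pow, one_mul]

theorem quo_bdry_omega_mul (hψ : IsOmegaEquivariant n ψ) (u : Circle) :
    quo n ψ (bdry (omega n * u)) = quo n ψ (bdry u) := by
  rw [← hψ.quo_rot_pow 1 (bdry u), pow_one]
  rfl

theorem periodic_quo_bdry (hψ : IsOmegaEquivariant n ψ) :
    Function.Periodic (fun x => quo n ψ (bdry (Circle.exp x))) (2 * Real.pi / n) := fun x => by
  change quo n ψ (bdry (Circle.exp (x + _))) = _
  rw [add_comm, Circle.exp_add, ← omega, hψ.quo_bdry_omega_mul]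

theorem exists_eq_rot_pow_of_quo_eq (hψ : IsOmegaEquivariant n ψ) (hn : n ≠ 0) {z z' : Disk}
    (heq : quo n ψ z = quo n ψ z') : ∃ j, z' = (rot (omega n) ^ j) z := by
  rw [quo, quo] at heq
  by_cases h0 : (ψ z : ℂ) = 0
  · rw [h0, zero_pow hn, eq_comm, pow_eq_zero_iff hn] at heq
    exact ⟨0, ψ.injective (Subtype.ext (heq.trans h0.symm))⟩
  · have : NeZero n := ⟨hn⟩
    have hroot : ((ψ z' : ℂ) / ψ z) ^ n = 1 := by
      rw [div_pow, ← heq, div_self (pow_ne_zero n h0)]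
    obtain ⟨j, -, hj⟩ := (isPrimitiveRoot_omega hn).eq_pow_of_pow_eq_one hroot
    refine ⟨j, ψ.injective (Subtype.ext ?_)⟩
    rw [hψ.map_rot_pow, coe_rot_pow, hj, div_mul_cancel₀ _ h0]

theorem mem_factorDomain_iff (hψ : IsOmegaEquivariant n ψ) (h : 3 ≤ n * p) {w : ℂ} :
    w ∈ factorDomain n p ψ ↔ ∃ s, ∃ y ∈ piece n p (zeroIndex h) s, quo n ψ y = w := by
  rw [factorDomain_eq_image]
  constructor
  · rintro ⟨z, hz, rfl⟩
    obtain ⟨j, s, y, hy, rfl⟩ := exists_eq_rot_pow_of_mem_baseDomain h hz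
    exact ⟨s, y, hy, (hψ.quo_rot_pow j y).symm⟩
  · rintro ⟨s, y, hy, rfl⟩
    exact ⟨y, (mem_baseDomain_iff h y).2 ⟨_, s, hy⟩, rfl⟩

theorem quo_mem_factorDomain_iff (hψ : IsOmegaEquivariant n ψ) (h : 3 ≤ n * p) {z : Disk} :
    quo n ψ z ∈ factorDomain n p ψ ↔ z ∈ baseDomain n p := by
  rw [factorDomain_eq_image]
  refine ⟨?_, mem_image_of_mem _⟩
  rintro ⟨z', hz', heq⟩
  obtain ⟨j, rfl⟩ := hψ.exists_eq_rot_pow_of_quo_eq (pos_of_three_le h).ne' heq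
  exact rot_pow_mem_baseDomain h hz' j

theorem eq_of_quo_eq (hψ : IsOmegaEquivariant n ψ) (h : 3 ≤ n * p) {s s' : Fin p} {y y' : Disk}
    (hy : y ∈ piece n p (zeroIndex h) s) (hy' : y' ∈ piece n p (zeroIndex h) s')
    (heq : quo n ψ y = quo n ψ y') : s = s' ∧ y = y' := by
  obtain ⟨j, rfl⟩ := hψ.exists_eq_rot_pow_of_quo_eq (pos_of_three_le h).ne' heq
  exact (eq_of_rot_pow_mem_piece h hy hy').imp_right Eq.symm

theorem factorBowenSeries_quo (hψ : IsOmegaEquivariant n ψ) (h : 3 ≤ n * p) {z : Disk}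
    (hz : z ∈ baseDomain n p) :
    factorBowenSeries h ψ (quo n ψ z) = quo n ψ (baseBowenSeries h z) := by
  have hex : ∃ x : Disk, (x : ℂ) ^ n = quo n ψ z := ⟨ψ z, rfl⟩
  have hquo : quo n ψ (ψ.symm hex.choose) = quo n ψ z := by
    rw [quo, ψ.apply_symm_apply]
    exact hex.choose_spec
  rw [factorBowenSeries, dif_pos hex, bowenSeries]
  change quo n ψ (baseBowenSeries h (ψ.symm hex.choose)) = _
  obtain ⟨i, s, y, hy, rfl⟩ := exists_eq_rot_pow_of_mem_baseDomain h hz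
  obtain ⟨j, hj⟩ := hψ.exists_eq_rot_pow_of_quo_eq (pos_of_three_le h).ne'
    (hquo.trans (hψ.quo_rot_pow i y)).symm
  rw [hj, baseBowenSeries_rot_pow h hy, baseBowenSeries_rot_pow h hy, hψ.quo_rot_pow,
    hψ.quo_rot_pow]

theorem factorBowenSeries_quo_of_mem_piece (hψ : IsOmegaEquivariant n ψ) (h : 3 ≤ n * p)
    {s : Fin p} {y : Disk} (hy : y ∈ piece n p (zeroIndex h) s) :
    factorBowenSeries h ψ (quo n ψ y) = quo n ψ (pairingOne h s y) := by
  rw [hψ.factorBowenSeries_quo h ((mem_baseDomain_iff h y).2 ⟨_, s, hy⟩)]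
  exact congrArg (quo n ψ) (baseBowenSeries_rot_pow h hy 0)

theorem factorBowenSeries_quo_bdry (hψ : IsOmegaEquivariant n ψ) (h : 3 ≤ n * p) (θ : ℝ) :
    factorBowenSeries h ψ (quo n ψ (bdry (Circle.exp θ))) =
      quo n ψ (bdry (Circle.exp (baseLift h θ))) := by
  have hα := halfAngle_pos h
  have hp : (0 : ℝ) < p := Nat.cast_pos.2 (Nat.pos_of_ne_zero (by rintro rfl; omega))
  have hT := two_pi_div_eq h
  have hlift (x : ℝ) : baseLift h (x + 2 * Real.pi / n) =
      baseLift h x + (n * p - 1 : ℤ) • (2 * Real.pi / n) := by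
    rw [hT, mul_comm _ (p : ℝ), ← nsmul_eq_mul, AddConstMapClass.map_add_nsmul, nsmul_eq_mul,
      nsmul_eq_mul, zsmul_eq_mul]
    push_cast
    linear_combination -2 * p * halfAngle_mul h
  have hper : Function.Periodic (fun x => (quo n ψ (bdry (Circle.exp x)),
      quo n ψ (bdry (Circle.exp (baseLift h x))))) (2 * Real.pi / n) := fun x =>
    Prod.ext (hψ.periodic_quo_bdry x) (by
      simpa only [hlift] using hψ.periodic_quo_bdry.zsmul (n * p - 1) (baseLift h x))
  obtain ⟨θ', ⟨hθ0, hθ1⟩, hθ'⟩ := hper.exists_mem_Ico₀ (by rw [hT]; positivity) θ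
  obtain ⟨hθ₁, hθ₂⟩ := Prod.mk.inj hθ'
  have hk : ⌊θ' / (2 * halfAngle n p)⌋₊ < p := by
    rw [Nat.floor_lt (by positivity), div_lt_iff₀ (by positivity)]
    linarith
  have harc := (mem_arcAngles_iff h hθ0 _).2 (rfl : ⌊θ' / (2 * halfAngle n p)⌋₊ = _)
  have hmem : bdry (Circle.exp θ') ∈ piece n p (zeroIndex h) ⟨_, hk⟩ :=
    bdry_mem_piece h (by rwa [zero_mul, zero_add])
  rw [hθ₁, hθ₂, hψ.factorBowenSeries_quo_of_mem_piece h hmem,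
    pairingOne_bdry h _ (abs_sub_midAngle_le (Ico_subset_Icc_self harc)), hψ.quo_bdry_omega_mul]

/-- At the endpoint that a half-plane does not share with its piece, this says that the two
possible values of the Bowen-Series map have the same image in the quotient. -/
theorem factorBowenSeries_quo_of_mem_halfPlane (hψ : IsOmegaEquivariant n ψ) (h : 3 ≤ n * p)
    {s : Fin p} {y : Disk} (hy : y ∈ halfPlane n p (zeroIndex h) s) :
    factorBowenSeries h ψ (quo n ψ y) = quo n ψ (pairingOne h s y) := by
  by_cases hv : y = vertex n p (s + 1)
  · have hα := halfAngle_pos h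
    rw [hv, vertex, hψ.factorBowenSeries_quo_bdry h, pairingOne_bdry h s, hψ.quo_bdry_omega_mul]
    push_cast
    exact abs_sub_midAngle_le ⟨by linarith, le_rfl⟩
  · refine hψ.factorBowenSeries_quo_of_mem_piece h ((mem_piece_zeroIndex_iff h s y).2 ⟨?_, hv⟩)
    rwa [mem_halfPlane_iff h, zero_mul, zero_add] at hy

theorem factorDomain_eq_iUnion (hψ : IsOmegaEquivariant n ψ) (h : 3 ≤ n * p) :
    factorDomain n p ψ = ⋃ s, quo n ψ '' halfPlane n p (zeroIndex h) s := by
  ext w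
  rw [mem_iUnion]
  constructor
  · rw [hψ.mem_factorDomain_iff h]
    rintro ⟨s, y, hy, rfl⟩
    exact ⟨s, y, hy.1, rfl⟩
  · rintro ⟨s, y, hy, rfl⟩
    exact (hψ.quo_mem_factorDomain_iff h).2
      ((mem_baseDomain_iff h y).2 (exists_mem_piece_of_mem_halfPlane h hy))

theorem isCompact_factorDomain (hψ : IsOmegaEquivariant n ψ) (h : 3 ≤ n * p) :
    IsCompact (factorDomain n p ψ) := by
  rw [hψ.factorDomain_eq_iUnion h]
  exact isCompact_iUnion fun s => (isClosed_halfPlane _ s).isCompact.image continuous_quo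

theorem continuousOn_factorBowenSeries (hψ : IsOmegaEquivariant n ψ) (h : 3 ≤ n * p) :
    ContinuousOn (factorBowenSeries h ψ) (factorDomain n p ψ) := by
  rw [hψ.factorDomain_eq_iUnion h]
  refine (locallyFinite_of_finite _).continuousOn_iUnion
    (fun s => ((isClosed_halfPlane _ s).isCompact.image continuous_quo).isClosed) fun s => ?_
  set K := halfPlane n p (zeroIndex h) s
  have : CompactSpace K := isCompact_iff_compactSpace.1 (isClosed_halfPlane _ s).isCompact
  have hcont : Continuous (K.imageFactorization (quo n ψ)) :=
    (continuous_quo.comp continuous_subtype_val).subtype_mk _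
  have hquot : IsQuotientMap (K.imageFactorization (quo n ψ)) :=
    hcont.isClosedMap.isQuotientMap hcont imageFactorization_surjective
  have hcomp : (quo n ψ '' K).domRestrict (factorBowenSeries h ψ) ∘
      K.imageFactorization (quo n ψ) = fun z : K => quo n ψ (pairingOne h s z) :=
    funext fun z => hψ.factorBowenSeries_quo_of_mem_halfPlane h z.2
  rw [continuousOn_iff_continuous_domRestrict, hquot.continuous_iff, hcomp]
  exact continuous_quo.comp ((pairingOne h s).continuous.comp continuous_subtype_val)

theorem map_coe_nhds (hψ : IsOmegaEquivariant n ψ) {y : Disk} (hy1 : ‖(y : ℂ)‖ < 1) :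
    map (fun z => (ψ z : ℂ)) (𝓝 y) = 𝓝 (ψ y : ℂ) := by
  have hball : Metric.closedBall (0 : ℂ) 1 ∈ 𝓝 (ψ y : ℂ) := mem_of_superset
    (Metric.isOpen_ball.mem_nhds (mem_ball_zero_iff.2 ((hψ.norm_lt_one_iff y).2 hy1)))
    Metric.ball_subset_closedBall
  rw [← map_nhds_subtype_coe_eq_nhds (ψ y).2 hball, Subtype.coe_eta, ← ψ.map_nhds_eq, map_map]
  rfl

theorem quo_image_mem_nhds (hψ : IsOmegaEquivariant n ψ) (hn : n ≠ 0) {y : Disk}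
    (hy1 : ‖(y : ℂ)‖ < 1) {S : Set Disk} (hS : S ∈ 𝓝 y) : quo n ψ '' S ∈ 𝓝 (quo n ψ y) := by
  have : NeZero n := ⟨hn⟩
  have himage := image_mem_map (m := fun z => (ψ z : ℂ)) hS
  rw [hψ.map_coe_nhds hy1] at himage
  have hpow := (isOpenQuotientMap_pow n).isOpenMap.image_mem_nhds himage
  rwa [image_image] at hpow

theorem quo_notMem_interior_factorDomain (hψ : IsOmegaEquivariant n ψ) (h : 3 ≤ n * p)
    {s : Fin p} {y : Disk} (hy1 : ‖(y : ℂ)‖ < 1) (hy : sideFun n p s y = 0) :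
    quo n ψ y ∉ interior (factorDomain n p ψ) := by
  intro hint
  have hlim : Tendsto (fun t : ℝ => (t * y : ℂ)) (𝓝[<] 1) (𝓝 (y : ℂ)) := by
    have hcont : Continuous fun t : ℝ => (t * y : ℂ) := by fun_prop
    simpa using (hcont.tendsto 1).mono_left nhdsWithin_le_nhds
  have hcl : y ∈ closure {z : Disk | (z : ℂ) ∈ interior (polygon n p)} := by
    rw [closure_subtype]
    refine mem_closure_of_tendsto hlim ?_
    filter_upwards [Ioo_mem_nhdsLT one_pos] with t ht
    have hty := real_mul_mem_interior_polygon h (r := zeroIndex h) (s := s) hy1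
      (by rwa [zero_mul, zero_add]) ht
    exact ⟨⟨t * y, mem_closedBall_zero_iff.2 (interior_subset hty).1.le⟩, hty, rfl⟩
  obtain ⟨z, hz, hzP⟩ := mem_closure_iff.1 hcl _ (isOpen_interior.preimage continuous_quo) hint
  exact (hψ.quo_mem_factorDomain_iff h).1 (interior_subset hz) hzP

theorem quo_mem_interior_factorDomain (hψ : IsOmegaEquivariant n ψ) (h : 3 ≤ n * p)
    {s : Fin p} {y : Disk} (hy1 : ‖(y : ℂ)‖ < 1) (hy : sideFun n p s y < 0) :
    quo n ψ y ∈ interior (factorDomain n p ψ) := by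
  have hnorm : Continuous fun z : Disk => ‖(z : ℂ)‖ := by fun_prop
  have hside : Continuous fun z : Disk => sideFun n p s z := by
    unfold sideFun
    fun_prop
  have hopen : IsOpen {z : Disk | ‖(z : ℂ)‖ < 1 ∧ sideFun n p s z < 0} :=
    (isOpen_lt hnorm continuous_const).inter (isOpen_lt hside continuous_const)
  refine mem_interior_iff_mem_nhds.2 (mem_of_superset
    (hψ.quo_image_mem_nhds (pos_of_three_le h).ne' hy1 (hopen.mem_nhds ⟨hy1, hy⟩)) ?_)
  rintro _ ⟨z, hz, rfl⟩
  refine (hψ.mem_factorDomain_iff h).2 ⟨s, z, mem_piece_of_norm_lt h ?_ hz.1, rfl⟩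
  rw [zero_mul, zero_add]
  exact hz.2.le

theorem quo_mem_interior_factorDomain_iff (hψ : IsOmegaEquivariant n ψ) (h : 3 ≤ n * p)
    {s : Fin p} {y : Disk} (hy : y ∈ piece n p (zeroIndex h) s) :
    quo n ψ y ∈ interior (factorDomain n p ψ) ↔ ‖(y : ℂ)‖ < 1 ∧ sideFun n p s y < 0 := by
  refine ⟨fun hint => ?_, fun hy' => hψ.quo_mem_interior_factorDomain h hy'.1 hy'.2⟩
  have hy1 : ‖(y : ℂ)‖ < 1 := by
    rw [← hψ.norm_quo_lt_one_iff (pos_of_three_le h).ne', ← mem_ball_zero_iff,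
      ← interior_closedBall _ one_ne_zero]
    exact interior_mono factorDomain_subset hint
  exact ⟨hy1, ((mem_piece_zeroIndex_iff h s y).1 hy).1.lt_of_ne
    fun hy0 => hψ.quo_notMem_interior_factorDomain h hy1 hy0 hint⟩

theorem boundaryCurves_eq (hψ : IsOmegaEquivariant n ψ) (h : 3 ≤ n * p) :
    boundaryCurves n p ψ =
      (factorDomain n p ψ \ interior (factorDomain n p ψ)) ∩ Metric.ball 0 1 := by
  rw [boundaryCurves, (hψ.isCompact_factorDomain h).isClosed.frontier_eq]

theorem quo_mem_boundaryCurves_iff (hψ : IsOmegaEquivariant n ψ) (h : 3 ≤ n * p)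
    {s : Fin p} {y : Disk} (hy : y ∈ piece n p (zeroIndex h) s) :
    quo n ψ y ∈ boundaryCurves n p ψ ↔ ‖(y : ℂ)‖ < 1 ∧ sideFun n p s y = 0 := by
  have hmem : quo n ψ y ∈ factorDomain n p ψ := (hψ.mem_factorDomain_iff h).2 ⟨s, y, hy, rfl⟩
  have hle := ((mem_piece_zeroIndex_iff h s y).1 hy).1
  rw [hψ.boundaryCurves_eq h, mem_inter_iff, Set.mem_sdiff, mem_ball_zero_iff,
    hψ.norm_quo_lt_one_iff (pos_of_three_le h).ne', hψ.quo_mem_interior_factorDomain_iff h hy,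
    ← hle.not_lt_iff_eq]
  tauto

theorem mem_boundaryCurves_iff (hψ : IsOmegaEquivariant n ψ) (h : 3 ≤ n * p) {w : ℂ} :
    w ∈ boundaryCurves n p ψ ↔ ∃ s, ∃ y ∈ piece n p (zeroIndex h) s,
      (‖(y : ℂ)‖ < 1 ∧ sideFun n p s y = 0) ∧ quo n ψ y = w := by
  constructor
  · intro hw
    obtain ⟨s, y, hy, rfl⟩ := (hψ.mem_factorDomain_iff h).1 ((hψ.boundaryCurves_eq h).le hw).1.1
    exact ⟨s, y, hy, (hψ.quo_mem_boundaryCurves_iff h hy).1 hw, rfl⟩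
  · rintro ⟨s, y, hy, hside, rfl⟩
    exact (hψ.quo_mem_boundaryCurves_iff h hy).2 hside

end IsOmegaEquivariant

theorem pairingOne_mem_side_iff (h : 3 ≤ n * p) (s : Fin p) (y : Disk) :
    ‖(pairingOne h s y : ℂ)‖ < 1 ∧ sideFun n p s.rev (pairingOne h s y) = 0 ↔
      ‖(y : ℂ)‖ < 1 ∧ sideFun n p s y = 0 :=
  and_congr (norm_pairingOne_lt_one_iff h s y) (sideFun_pairingOne_eq_zero_iff h s y)

theorem mem_piece_of_mem_side (h : 3 ≤ n * p) {s : Fin p} {y : Disk}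
    (hy : ‖(y : ℂ)‖ < 1 ∧ sideFun n p s y = 0) : y ∈ piece n p (zeroIndex h) s :=
  mem_piece_of_norm_lt h (by rw [zero_mul, zero_add]; exact hy.2.le) hy.1

namespace IsOmegaEquivariant

theorem bijOn_boundaryCurves (hψ : IsOmegaEquivariant n ψ) (h : 3 ≤ n * p) :
    BijOn (factorBowenSeries h ψ) (boundaryCurves n p ψ) (boundaryCurves n p ψ) := by
  refine ⟨fun w hw => ?_, fun w hw w' hw' heq => ?_, fun w hw => ?_⟩
  · obtain ⟨s, y, hy, hside, rfl⟩ := (hψ.mem_boundaryCurves_iff h).1 hw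
    have hside' := (pairingOne_mem_side_iff h s y).2 hside
    rw [hψ.factorBowenSeries_quo_of_mem_piece h hy]
    exact (hψ.mem_boundaryCurves_iff h).2 ⟨_, _, mem_piece_of_mem_side h hside', hside', rfl⟩
  · obtain ⟨s, y, hy, hside, rfl⟩ := (hψ.mem_boundaryCurves_iff h).1 hw
    obtain ⟨s', y', hy', hside', rfl⟩ := (hψ.mem_boundaryCurves_iff h).1 hw'
    rw [hψ.factorBowenSeries_quo_of_mem_piece h hy,
      hψ.factorBowenSeries_quo_of_mem_piece h hy'] at heq
    obtain ⟨hs, hyy⟩ := hψ.eq_of_quo_eq h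
      (mem_piece_of_mem_side h ((pairingOne_mem_side_iff h s y).2 hside))
      (mem_piece_of_mem_side h ((pairingOne_mem_side_iff h s' y').2 hside')) heq
    obtain rfl := Fin.rev_injective hs
    rw [(pairingOne h s).injective hyy]
  · obtain ⟨s, y, -, hside, rfl⟩ := (hψ.mem_boundaryCurves_iff h).1 hw
    obtain ⟨z, rfl⟩ := (pairingOne h s.rev).surjective y
    have hside' := (pairingOne_mem_side_iff h s.rev z).1 (by rwa [Fin.rev_rev])
    have hz := mem_piece_of_mem_side h hside'
    exact ⟨quo n ψ z, (hψ.mem_boundaryCurves_iff h).2 ⟨_, z, hz, hside', rfl⟩,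
      hψ.factorBowenSeries_quo_of_mem_piece h hz⟩

theorem sphere_subset_factorDomain (hψ : IsOmegaEquivariant n ψ) (h : 3 ≤ n * p) :
    Metric.sphere 0 1 ⊆ factorDomain n p ψ := by
  intro w hw
  rw [mem_sphere_zero_iff_norm] at hw
  have hn := (pos_of_three_le h).ne'
  obtain ⟨z, rfl⟩ := exists_quo_eq (ψ := ψ) hn hw.le
  rw [hψ.norm_quo_eq_one_iff hn] at hw
  exact (hψ.quo_mem_factorDomain_iff h).2
    ((mem_baseDomain_iff h z).2 (exists_mem_piece_of_norm_eq_one h hw))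

theorem mapsTo_factorBowenSeries (hψ : IsOmegaEquivariant n ψ) (h : 3 ≤ n * p) :
    MapsTo (factorBowenSeries h ψ) (factorDomain n p ψ) (Metric.closedBall 0 1) := by
  intro w hw
  obtain ⟨s, y, hy, rfl⟩ := (hψ.mem_factorDomain_iff h).1 hw
  rw [hψ.factorBowenSeries_quo_of_mem_piece h hy, mem_closedBall_zero_iff]
  exact norm_quo_le _

theorem norm_factorBowenSeries_lt_one_iff (hψ : IsOmegaEquivariant n ψ) (h : 3 ≤ n * p) {w : ℂ}
    (hw : w ∈ factorDomain n p ψ) : ‖factorBowenSeries h ψ w‖ < 1 ↔ ‖w‖ < 1 := by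
  have hn := (pos_of_three_le h).ne'
  obtain ⟨s, y, hy, rfl⟩ := (hψ.mem_factorDomain_iff h).1 hw
  rw [hψ.factorBowenSeries_quo_of_mem_piece h hy, hψ.norm_quo_lt_one_iff hn,
    hψ.norm_quo_lt_one_iff hn, norm_pairingOne_lt_one_iff]

theorem norm_factorBowenSeries_eq_one (hψ : IsOmegaEquivariant n ψ) (h : 3 ≤ n * p) {w : ℂ}
    (hw : ‖w‖ = 1) : ‖factorBowenSeries h ψ w‖ = 1 := by
  have hmem := hψ.sphere_subset_factorDomain h (mem_sphere_zero_iff_norm.2 hw)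
  have hle := mem_closedBall_zero_iff.1 (hψ.mapsTo_factorBowenSeries h hmem)
  rw [← hle.not_lt_iff_eq, hψ.norm_factorBowenSeries_lt_one_iff h hmem, hw]
  exact lt_irrefl 1

theorem mem_interior_of_factorBowenSeries (hψ : IsOmegaEquivariant n ψ) (h : 3 ≤ n * p) {w : ℂ}
    (hw : w ∈ factorDomain n p ψ) (hlt : ‖factorBowenSeries h ψ w‖ < 1)
    (hcurve : factorBowenSeries h ψ w ∉ boundaryCurves n p ψ) :
    w ∈ interior (factorDomain n p ψ) := by
  by_contra hint
  refine hcurve ((hψ.bijOn_boundaryCurves h).mapsTo ?_)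
  rw [hψ.boundaryCurves_eq h]
  exact ⟨⟨hw, hint⟩, mem_ball_zero_iff.2 ((hψ.norm_factorBowenSeries_lt_one_iff h hw).1 hlt)⟩

theorem map_zero (hψ : IsOmegaEquivariant n ψ) (hn : 2 ≤ n) : (ψ 0 : ℂ) = 0 := by
  have hfix : (omega n : ℂ) * ψ 0 = ψ 0 := by
    have hrot : rot (omega n) 0 = 0 := Subtype.ext (mul_zero _)
    have hmap := congrArg Subtype.val (hψ.map_omega 0)
    rw [hrot] at hmap
    exact hmap.symm
  exact (mul_left_eq_self₀.1 hfix).resolve_left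
    ((isPrimitiveRoot_omega (by omega)).ne_one (by omega))

theorem quo_eq_zero_iff (hψ : IsOmegaEquivariant n ψ) (hn : 2 ≤ n) (z : Disk) :
    quo n ψ z = 0 ↔ z = 0 := by
  rw [quo, pow_eq_zero_iff (by omega), ← ψ.injective.eq_iff, Subtype.ext_iff, hψ.map_zero hn]

theorem eq_one_of_zero_mem_factorDomain (hψ : IsOmegaEquivariant n ψ) (h : 3 ≤ n * p)
    (h0 : (0 : ℂ) ∈ factorDomain n p ψ) : n = 1 := by
  have hn := pos_of_three_le h
  obtain ⟨s, y, hy, hy0⟩ := (hψ.mem_factorDomain_iff h).1 h0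
  by_contra hn1
  rw [hψ.quo_eq_zero_iff (by omega)] at hy0
  exact (norm_pos_of_mem_piece h hy).ne' (by rw [hy0]; exact norm_zero)

end IsOmegaEquivariant

end

/-! ### Local form of the factor map -/

theorem exists_analyticAt_rightInverse {𝕜 : Type*} [NontriviallyNormedField 𝕜]
    [CompleteSpace 𝕜] [CharZero 𝕜] {f : 𝕜 → 𝕜} {x : 𝕜} (hf : AnalyticAt 𝕜 f x)
    (hf' : deriv f x ≠ 0) :
    ∃ ρ : 𝕜 → 𝕜, AnalyticAt 𝕜 ρ (f x) ∧ deriv ρ (f x) ≠ 0 ∧ ρ (f x) = x ∧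
      ∀ᶠ w in 𝓝 (f x), f (ρ w) = w := by
  set ρ := hf.hasStrictDerivAt.localInverse _ _ _ hf'
  have hρ : AnalyticAt 𝕜 ρ (f x) := hf.analyticAt_localInverse hf'
  have hinv : f ∘ ρ =ᶠ[𝓝 (f x)] id := HasStrictDerivAt.eventually_right_inverse ..
  have hρx : ρ (f x) = x := HasStrictFDerivAt.localInverse_apply_image ..
  refine ⟨ρ, hρ, fun h0 => ?_, hρx, hinv⟩
  have hchain := hinv.deriv_eq
  rw [deriv_comp _ (hρx.symm ▸ hf.differentiableAt) hρ.differentiableAt, h0, mul_zero,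
    deriv_id] at hchain
  exact zero_ne_one hchain

/-- The Möbius map `z ↦ (a z + b) / (b̄ z + ā)` of `IsDiskAut`. -/
def moebius (a b z : ℂ) : ℂ := (a * z + b) / ((starRingEnd ℂ) b * z + (starRingEnd ℂ) a)

section Moebius

variable {a b z : ℂ}

theorem moebius_denominator_ne_zero (hab : ‖b‖ < ‖a‖) (hz : ‖z‖ ≤ 1) :
    (starRingEnd ℂ) b * z + (starRingEnd ℂ) a ≠ 0 := by
  intro h0
  have hnorm : ‖a‖ = ‖b‖ * ‖z‖ := by
    rw [← RCLike.norm_conj a, eq_neg_of_add_eq_zero_right h0, norm_neg, norm_mul, RCLike.norm_conj]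
  exact hab.not_ge (hnorm.trans_le (mul_le_of_le_one_right (norm_nonneg b) hz))

theorem analyticAt_moebius (hab : ‖b‖ < ‖a‖) (hz : ‖z‖ ≤ 1) : AnalyticAt ℂ (moebius a b) z :=
  AnalyticAt.fun_div (by fun_prop) (by fun_prop) (moebius_denominator_ne_zero hab hz)

theorem deriv_moebius_ne_zero (hab : ‖b‖ < ‖a‖) (hz : ‖z‖ ≤ 1) : deriv (moebius a b) z ≠ 0 := by
  have hden := moebius_denominator_ne_zero hab hz
  have hderiv := (((hasDerivAt_id z).const_mul a).add_const b).fun_div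
    (((hasDerivAt_id z).const_mul ((starRingEnd ℂ) b)).add_const ((starRingEnd ℂ) a)) hden
  have hdet : a * 1 * ((starRingEnd ℂ) b * z + (starRingEnd ℂ) a) -
      (a * z + b) * ((starRingEnd ℂ) b * 1) = ((‖a‖ ^ 2 - ‖b‖ ^ 2 : ℝ) : ℂ) := by
    push_cast
    rw [← mul_conj', ← mul_conj']
    ring
  have hpos : 0 < ‖a‖ ^ 2 - ‖b‖ ^ 2 := sub_pos.2 (pow_lt_pow_left₀ hab (norm_nonneg b) two_ne_zero)
  refine hderiv.deriv.trans_ne (div_ne_zero ?_ (pow_ne_zero 2 hden))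
  exact hdet.trans_ne (ofReal_ne_zero.2 hpos.ne')

end Moebius

/-- The homeomorphisms of the closed disk that preserve the open disk, commute with `M_ω`, preserve
the orientation of the circle and conjugate the side pairings `g_{1,s}` to Möbius automorphisms:
the conditions of `InducesTeichOmega` without quasiconformality and without the normalization at
`1`. -/
structure IsTopologicalDeformation {n p : ℕ} (h : 3 ≤ n * p) (ψ : Disk ≃ₜ Disk) : Prop
    extends IsOmegaEquivariant n ψ where
  orientationPreserving : OrientationPreserving (fun u => (ψ (bdry u) : ℂ))
  isDiskAut_conj : ∀ s, IsDiskAut (ψ * pairingOne h s * ψ⁻¹)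

section

variable {n p : ℕ} {h : 3 ≤ n * p} {ψ : Disk ≃ₜ Disk}

theorem IsOmegaEquivariant.exists_localSection (hψ : IsOmegaEquivariant n ψ) (hn : n ≠ 0)
    {y : Disk} (hy1 : ‖(y : ℂ)‖ < 1) (h0 : quo n ψ y = 0 → n = 1) :
    ∃ ρ : ℂ → ℂ, AnalyticAt ℂ ρ (quo n ψ y) ∧ deriv ρ (quo n ψ y) ≠ 0 ∧
      ρ (quo n ψ y) = ψ y ∧
      ∀ S ∈ 𝓝 y, ∀ᶠ w in 𝓝 (quo n ψ y), ∃ z ∈ S, (ψ z : ℂ) = ρ w ∧ quo n ψ z = w := by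
  have hderiv : deriv (fun x : ℂ => x ^ n) (ψ y) ≠ 0 := by
    rw [deriv_pow_field]
    refine mul_ne_zero (Nat.cast_ne_zero.2 hn) fun hpow => ?_
    obtain ⟨hψy, hn1⟩ := pow_eq_zero_iff'.1 hpow
    exact hn1 (by rw [h0 (by rw [quo, hψy, zero_pow hn])])
  obtain ⟨ρ, hρ, hρ', hρy, hρinv⟩ :=
    exists_analyticAt_rightInverse (analyticAt_id.pow n) hderiv
  refine ⟨ρ, hρ, hρ', hρy, fun S hS => ?_⟩
  have hmem : (fun z => (ψ z : ℂ)) '' S ∈ 𝓝 (ρ (quo n ψ y)) := by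
    rw [show ρ (quo n ψ y) = ψ y from hρy, ← hψ.map_coe_nhds hy1]
    exact image_mem_map hS
  filter_upwards [hρ.continuousAt.eventually_mem hmem, hρinv] with w ⟨z, hz, hzw⟩ hw
  exact ⟨z, hz, hzw, (congrArg (· ^ n) hzw).trans hw⟩

namespace IsTopologicalDeformation

theorem exists_moebius (hψ : IsTopologicalDeformation h ψ) (s : Fin p) :
    ∃ a b : ℂ, ‖b‖ < ‖a‖ ∧ ∀ z, (ψ (pairingOne h s z) : ℂ) = moebius a b (ψ z) := by
  obtain ⟨a, b, hab, hg⟩ := hψ.isDiskAut_conj s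
  refine ⟨a, b, hab, fun z => ?_⟩
  rw [moebius, ← hg (ψ z), Homeomorph.mul_apply, Homeomorph.mul_apply]
  congr 3
  exact (ψ.symm_apply_apply z).symm

theorem exists_eventuallyEq_pow (hψ : IsTopologicalDeformation h ψ) {w : ℂ}
    (hw : w ∈ interior (factorDomain n p ψ)) :
    ∃ B : ℂ → ℂ, AnalyticAt ℂ B w ∧ deriv B w ≠ 0 ∧
      factorBowenSeries h ψ =ᶠ[𝓝 w] fun x => B x ^ n := by
  have hwD := interior_subset hw
  obtain ⟨s, y, hy, rfl⟩ := (hψ.mem_factorDomain_iff h).1 hwD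
  obtain ⟨hy1, hside⟩ := (hψ.quo_mem_interior_factorDomain_iff h hy).1 hw
  obtain ⟨ρ, hρ, hρ', hρy, hsection⟩ := hψ.exists_localSection (pos_of_three_le h).ne' hy1
    fun h0 => hψ.eq_one_of_zero_mem_factorDomain h (h0 ▸ hwD)
  obtain ⟨a, b, hab, hM⟩ := hψ.exists_moebius s
  have hρ1 : ‖ρ (quo n ψ y)‖ ≤ 1 := hρy ▸ (ψ y).norm_le
  have hMρ := analyticAt_moebius hab hρ1
  refine ⟨moebius a b ∘ ρ, hMρ.comp hρ, ?_, ?_⟩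
  · rw [deriv_comp _ hMρ.differentiableAt hρ.differentiableAt]
    exact mul_ne_zero (deriv_moebius_ne_zero hab hρ1) hρ'
  · have hcont : Continuous fun z : Disk => sideFun n p s z := by
      unfold sideFun
      fun_prop
    filter_upwards [hsection _ (hcont.continuousAt.eventually_lt_const hside)]
    rintro _ ⟨z, hz, hzρ, rfl⟩
    have hzh : z ∈ halfPlane n p (zeroIndex h) s := by
      rw [mem_halfPlane_iff h, zero_mul, zero_add]
      exact le_of_lt hz
    rw [hψ.factorBowenSeries_quo_of_mem_halfPlane h hzh, quo, hM, hzρ, Function.comp_apply]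

theorem analyticOnNhd_factorBowenSeries (hψ : IsTopologicalDeformation h ψ) :
    AnalyticOnNhd ℂ (factorBowenSeries h ψ) (interior (factorDomain n p ψ)) := by
  intro w hw
  obtain ⟨B, hB, -, hA⟩ := hψ.exists_eventuallyEq_pow hw
  exact (hB.pow n).congr hA.symm

theorem deriv_factorBowenSeries_ne_zero (hψ : IsTopologicalDeformation h ψ) {w : ℂ}
    (hw : w ∈ interior (factorDomain n p ψ)) (h0 : factorBowenSeries h ψ w = 0 → n = 1) :
    deriv (factorBowenSeries h ψ) w ≠ 0 := by
  have hn : n ≠ 0 := (pos_of_three_le h).ne'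
  obtain ⟨B, hB, hB', hA⟩ := hψ.exists_eventuallyEq_pow hw
  rw [hA.deriv_eq, (hB.differentiableAt.hasDerivAt.fun_pow n).deriv]
  refine mul_ne_zero (mul_ne_zero (Nat.cast_ne_zero.2 hn) fun hpow => ?_) hB'
  obtain ⟨hB0, hn1⟩ := pow_eq_zero_iff'.1 hpow
  exact hn1 (by rw [h0 (by rw [hA.self_of_nhds]; simp only [hB0, zero_pow hn])])

theorem analyticOrderAt_sub_eq_one (hψ : IsTopologicalDeformation h ψ) {w : ℂ}
    (hw : w ∈ interior (factorDomain n p ψ)) (h0 : factorBowenSeries h ψ w = 0 → n = 1) :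
    analyticOrderAt (fun x => factorBowenSeries h ψ x - factorBowenSeries h ψ w) w = 1 :=
  (hψ.analyticOnNhd_factorBowenSeries w hw).analyticOrderAt_sub_eq_one_of_deriv_ne_zero
    (hψ.deriv_factorBowenSeries_ne_zero hw h0)

theorem analyticOrderAt_of_eq_zero (hψ : IsTopologicalDeformation h ψ) {w : ℂ}
    (hw : w ∈ interior (factorDomain n p ψ)) (h0 : factorBowenSeries h ψ w = 0) :
    analyticOrderAt (factorBowenSeries h ψ) w = n := by
  obtain ⟨B, hB, hB', hA⟩ := hψ.exists_eventuallyEq_pow hw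
  have hB0 : B w = 0 := eq_zero_of_pow_eq_zero (hA.self_of_nhds.symm.trans h0)
  calc analyticOrderAt (factorBowenSeries h ψ) w = analyticOrderAt (B ^ n) w :=
        analyticOrderAt_congr hA
    _ = n := by
        rw [analyticOrderAt_pow hB, hB.analyticOrderAt_eq_one_of_zero_deriv_ne_zero hB0 hB',
          nsmul_eq_mul, mul_one]

theorem deriv_factorBowenSeries_eq_zero_iff (hψ : IsTopologicalDeformation h ψ) (hn : 2 ≤ n)
    {w : ℂ} (hw : w ∈ interior (factorDomain n p ψ)) :
    deriv (factorBowenSeries h ψ) w = 0 ↔ factorBowenSeries h ψ w = 0 := by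
  constructor
  · intro hderiv
    by_contra hA
    exact hψ.deriv_factorBowenSeries_ne_zero hw (fun h0 => absurd h0 hA) hderiv
  · intro h0
    by_contra hderiv
    have horder := (hψ.analyticOnNhd_factorBowenSeries w hw)
      |>.analyticOrderAt_eq_one_of_zero_deriv_ne_zero h0 hderiv
    rw [hψ.analyticOrderAt_of_eq_zero hw h0, Nat.cast_eq_one] at horder
    omega

end IsTopologicalDeformation

end

/-! ### Counting preimages -/

section

variable {n p : ℕ} {h : 3 ≤ n * p} {ψ : Disk ≃ₜ Disk}

theorem encard_setOf_quo_eq (hn : n ≠ 0) {w : ℂ} (hw : ‖w‖ ≤ 1) :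
    {y | quo n ψ y = w}.encard = {x : ℂ | x ^ n = w}.encard := by
  have hinj : (fun y => (ψ y : ℂ)).Injective := Subtype.val_injective.comp ψ.injective
  refine encard_preimage_of_injective_subset_range (t := {x | x ^ n = w}) hinj fun x hx => ?_
  have hx1 : ‖x‖ ≤ 1 := by
    rw [← pow_le_one_iff_of_nonneg (norm_nonneg x) hn, ← norm_pow]
    exact (congrArg norm hx).trans_le hw
  obtain ⟨y, hy⟩ := ψ.surjective ⟨x, mem_closedBall_zero_iff.2 hx1⟩
  exact ⟨y, congrArg Subtype.val hy⟩

namespace IsOmegaEquivariant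

/-- Every point `y` of the fibre over `w` has one preimage under each side pairing, which lies in
the half-plane of the pairing unless `y` lies in the piece of the paired side. -/
theorem bijOn_preimages (hψ : IsOmegaEquivariant n ψ) (w : ℂ) :
    BijOn (fun q : Fin p × Disk => quo n ψ ((pairingOne h q.1.rev).symm q.2))
      {q | quo n ψ q.2 = w ∧ q.2 ∉ piece n p (zeroIndex h) q.1}
      (factorPreimage h ψ {w} \ boundaryCurves n p ψ) := by
  have hpiece : ∀ (s : Fin p) (y : Disk), y ∉ piece n p (zeroIndex h) s ↔
      (pairingOne h s.rev).symm y ∈ piece n p (zeroIndex h) s.rev ∧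
        ¬ (‖((pairingOne h s.rev).symm y : ℂ)‖ < 1 ∧
          sideFun n p s.rev ((pairingOne h s.rev).symm y) = 0) := fun s y => by
    simpa only [Fin.rev_rev, Homeomorph.apply_symm_apply] using
      pairingOne_notMem_piece_iff h s.rev ((pairingOne h s.rev).symm y)
  refine ⟨?_, ?_, ?_⟩
  · rintro ⟨s, y⟩ ⟨hyw, hy⟩
    obtain ⟨hz, hcurve⟩ := (hpiece s y).1 hy
    refine ⟨⟨(hψ.mem_factorDomain_iff h).2 ⟨_, _, hz, rfl⟩, ?_⟩, ?_⟩
    · rw [mem_singleton_iff, hψ.factorBowenSeries_quo_of_mem_piece h hz,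
        Homeomorph.apply_symm_apply, hyw]
    · rwa [hψ.quo_mem_boundaryCurves_iff h hz]
  · rintro ⟨s, y⟩ ⟨-, hy⟩ ⟨s', y'⟩ ⟨-, hy'⟩ heq
    obtain ⟨hs, hyy'⟩ := hψ.eq_of_quo_eq h ((hpiece s y).1 hy).1 ((hpiece s' y').1 hy').1 heq
    obtain rfl := Fin.rev_injective hs
    rw [(pairingOne h s.rev).symm.injective hyy']
  · rintro _ ⟨⟨hx, hxw⟩, hcurve⟩
    obtain ⟨s, z, hz, rfl⟩ := (hψ.mem_factorDomain_iff h).1 hx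
    rw [mem_singleton_iff, hψ.factorBowenSeries_quo_of_mem_piece h hz] at hxw
    rw [hψ.quo_mem_boundaryCurves_iff h hz] at hcurve
    refine ⟨(s.rev, pairingOne h s z), ⟨hxw, ?_⟩, ?_⟩
    · exact (pairingOne_notMem_piece_iff h s z).2 ⟨hz, hcurve⟩
    · simp only [Fin.rev_rev, Homeomorph.symm_apply_apply]

theorem encard_preimages_of_notMem (hψ : IsOmegaEquivariant n ψ) {w : ℂ}
    (hw : w ∉ factorDomain n p ψ) :
    (factorPreimage h ψ {w} \ boundaryCurves n p ψ).encard =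
      p * {y | quo n ψ y = w}.encard := by
  have hset : {q : Fin p × Disk | quo n ψ q.2 = w ∧ q.2 ∉ piece n p (zeroIndex h) q.1} =
      univ ×ˢ {y | quo n ψ y = w} := by
    ext ⟨s, y⟩
    simp only [mem_ofPred_eq, mem_prod, mem_univ, true_and, and_iff_left_iff_imp]
    exact fun hy hpiece => hw ((hψ.mem_factorDomain_iff h).2 ⟨s, y, hpiece, hy⟩)
  have hbij := hψ.bijOn_preimages (h := h) w
  rw [← hbij.image_eq, hbij.injOn.encard_image, hset, encard_prod, encard_univ,
    ENat.card_eq_coe_fintype_card, Fintype.card_fin]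

theorem encard_preimages_of_mem (hψ : IsOmegaEquivariant n ψ) {w : ℂ}
    (hw : w ∈ factorDomain n p ψ) :
    (factorPreimage h ψ {w} \ boundaryCurves n p ψ).encard = (n * p - 1 : ℕ) := by
  obtain ⟨s, y, hy, hyw⟩ := (hψ.mem_factorDomain_iff h).1 hw
  have hset : {q : Fin p × Disk | quo n ψ q.2 = w ∧ q.2 ∉ piece n p (zeroIndex h) q.1} =
      (univ ×ˢ {y | quo n ψ y = w}) \ {(s, y)} := by
    ext ⟨s', y'⟩
    simp only [mem_ofPred_eq, Set.mem_sdiff, mem_prod, mem_univ, true_and, mem_singleton_iff,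
      Prod.mk.injEq]
    refine and_congr_right fun hy' => not_congr ⟨fun hpiece => ?_, ?_⟩
    · exact hψ.eq_of_quo_eq h hpiece hy (hy'.trans hyw.symm)
    · rintro ⟨rfl, rfl⟩
      exact hy
  have hn := (pos_of_three_le h).ne'
  have hfibre : {x : ℂ | x ^ n = w}.encard = n := by
    rcases eq_or_ne w 0 with rfl | h0
    · simp [hψ.eq_one_of_zero_mem_factorDomain h hw]
    · exact encard_setOf_pow_eq hn h0
  have hbij := hψ.bijOn_preimages (h := h) w
  have hmem : (s, y) ∈ (univ : Set (Fin p)) ×ˢ {y | quo n ψ y = w} := ⟨mem_univ s, hyw⟩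
  rw [← hbij.image_eq, hbij.injOn.encard_image, hset, encard_sdiff_singleton_of_mem hmem,
    encard_prod, encard_univ, ENat.card_eq_coe_fintype_card, Fintype.card_fin,
    encard_setOf_quo_eq hn (mem_closedBall_zero_iff.1 (factorDomain_subset hw)), hfibre, mul_comm]
  push_cast
  rfl

theorem setOf_mem_factorPreimage_eq (hψ : IsOmegaEquivariant n ψ) {V : Set ℂ}
    (hV : Disjoint V (boundaryCurves n p ψ)) {w : ℂ} (hw : w ∈ V) :
    {z ∈ factorPreimage h ψ V | factorBowenSeries h ψ z = w} =
      factorPreimage h ψ {w} \ boundaryCurves n p ψ := by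
  ext z
  constructor
  · rintro ⟨⟨hz, -⟩, rfl⟩
    exact ⟨⟨hz, rfl⟩, fun hcurve =>
      disjoint_left.1 hV hw ((hψ.bijOn_boundaryCurves h).mapsTo hcurve)⟩
  · rintro ⟨⟨hz, rfl⟩, -⟩
    exact ⟨⟨hz, hw⟩, rfl⟩

theorem factorPreimage_subset_interior (hψ : IsOmegaEquivariant n ψ) {V : Set ℂ}
    (hV : Disjoint V (boundaryCurves n p ψ)) (hV1 : V ⊆ Metric.ball 0 1) :
    factorPreimage h ψ V ⊆ interior (factorDomain n p ψ) :=
  fun _ hz => hψ.mem_interior_of_factorBowenSeries h hz.1 (mem_ball_zero_iff.1 (hV1 hz.2))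
    (disjoint_left.1 hV hz.2)

theorem disjoint_compl_boundaryCurves (hψ : IsOmegaEquivariant n ψ) (h : 3 ≤ n * p) :
    Disjoint (Metric.closedBall 0 1 \ factorDomain n p ψ) (boundaryCurves n p ψ) := by
  rw [hψ.boundaryCurves_eq h]
  exact disjoint_sdiff_left.mono_right (inter_subset_left.trans sdiff_subset)

theorem compl_subset_ball (hψ : IsOmegaEquivariant n ψ) (h : 3 ≤ n * p) :
    Metric.closedBall 0 1 \ factorDomain n p ψ ⊆ Metric.ball 0 1 := by
  rw [sdiff_subset_iff, union_comm, ← Metric.ball_union_sphere]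
  exact union_subset_union_right _ (hψ.sphere_subset_factorDomain h)

theorem zero_mem_compl_factorDomain (hψ : IsOmegaEquivariant n ψ) (h : 3 ≤ n * p)
    (hn : 2 ≤ n) :
    (0 : ℂ) ∈ Metric.closedBall 0 1 \ factorDomain n p ψ :=
  ⟨Metric.mem_closedBall_self zero_le_one, fun h0 => by
    have := hψ.eq_one_of_zero_mem_factorDomain h h0
    omega⟩

end IsOmegaEquivariant

namespace IsTopologicalDeformation

theorem hasDegree_of_forall (hψ : IsTopologicalDeformation h ψ) {V : Set ℂ}
    (hV : Disjoint V (boundaryCurves n p ψ)) (hV1 : V ⊆ Metric.ball 0 1) {d : ℕ}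
    (hcount : ∀ w ∈ V, ∃ k e : ℕ,
      (factorPreimage h ψ {w} \ boundaryCurves n p ψ).encard = k ∧
      (∀ z ∈ interior (factorDomain n p ψ), factorBowenSeries h ψ z = w →
        analyticOrderAt (fun x => factorBowenSeries h ψ x - w) z = e) ∧ k * e = d) :
    HasDegree (factorBowenSeries h ψ) (factorPreimage h ψ V) V d := by
  have hsub := hψ.factorPreimage_subset_interior (h := h) hV hV1
  refine ⟨hψ.analyticOnNhd_factorBowenSeries.mono hsub, fun z hz => hz.2, fun w hw => ?_⟩
  obtain ⟨k, e, hk, he, rfl⟩ := hcount w hw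
  rw [← hψ.setOf_mem_factorPreimage_eq hV hw] at hk
  have hfin := finite_of_encard_eq_coe hk
  refine ⟨hfin, ?_⟩
  rw [finsum_mem_congr rfl fun z hz => he z (hsub hz.1) hz.2,
    finsum_mem_eq_finite_toFinset_sum _ hfin, Finset.sum_const, nsmul_eq_mul, Nat.cast_mul, ← hk,
    hfin.encard_eq_coe_toFinset_card]

theorem hasDegree_interior (hψ : IsTopologicalDeformation h ψ) :
    HasDegree (factorBowenSeries h ψ) (factorPreimage h ψ (interior (factorDomain n p ψ)))
      (interior (factorDomain n p ψ)) (n * p - 1) := by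
  refine hψ.hasDegree_of_forall ?_ ?_ fun w hw => ⟨n * p - 1, 1,
    hψ.encard_preimages_of_mem (interior_subset hw), ?_, mul_one _⟩
  · exact disjoint_interior_frontier.mono_right inter_subset_left
  · rw [← interior_closedBall _ one_ne_zero]
    exact interior_mono factorDomain_subset
  · rintro z hz rfl
    exact hψ.analyticOrderAt_sub_eq_one hz fun h0 =>
      hψ.eq_one_of_zero_mem_factorDomain h (h0 ▸ interior_subset hw)

theorem hasDegree_compl (hψ : IsTopologicalDeformation h ψ) :
    HasDegree (factorBowenSeries h ψ)
      (factorPreimage h ψ (Metric.closedBall 0 1 \ factorDomain n p ψ))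
      (Metric.closedBall 0 1 \ factorDomain n p ψ) (n * p) := by
  have hn : n ≠ 0 := (pos_of_three_le h).ne'
  refine hψ.hasDegree_of_forall (hψ.disjoint_compl_boundaryCurves h) (hψ.compl_subset_ball h)
    fun w hw => ?_
  have hcard := hψ.encard_preimages_of_notMem (h := h) hw.2
  rw [encard_setOf_quo_eq hn (mem_closedBall_zero_iff.1 hw.1)] at hcard
  rcases eq_or_ne w 0 with rfl | h0
  · refine ⟨p, n, ?_, fun z hz hz0 => ?_, mul_comm p n⟩
    · simpa [pow_eq_zero_iff hn] using hcard
    · simpa only [sub_zero] using hψ.analyticOrderAt_of_eq_zero hz hz0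
  · refine ⟨p * n, 1, ?_, ?_, by rw [mul_one, mul_comm]⟩
    · rw [hcard, encard_setOf_pow_eq hn h0, Nat.cast_mul]
    · rintro z hz rfl
      exact hψ.analyticOrderAt_sub_eq_one hz fun hz0 => absurd hz0 h0

theorem criticalPoints_eq (hψ : IsTopologicalDeformation h ψ) (hn : 2 ≤ n) :
    criticalPoints h ψ = factorPreimage h ψ {0} \ boundaryCurves n p ψ := by
  have hdisj := hψ.disjoint_compl_boundaryCurves h
  rw [← hψ.setOf_mem_factorPreimage_eq hdisj (hψ.zero_mem_compl_factorDomain h hn)]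
  ext z
  constructor
  · rintro ⟨hz, hderiv⟩
    have hz0 := (hψ.deriv_factorBowenSeries_eq_zero_iff hn hz).1 hderiv
    exact ⟨⟨interior_subset hz, hz0 ▸ hψ.zero_mem_compl_factorDomain h hn⟩, hz0⟩
  · rintro ⟨hz, hz0⟩
    have hint := hψ.factorPreimage_subset_interior hdisj (hψ.compl_subset_ball h) hz
    exact ⟨hint, (hψ.deriv_factorBowenSeries_eq_zero_iff hn hint).2 hz0⟩

theorem encard_criticalPoints (hψ : IsTopologicalDeformation h ψ) (hn : 2 ≤ n) :
    (criticalPoints h ψ).encard = p := by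
  have hfibre : {y | quo n ψ y = 0} = {0} := Set.ext (hψ.quo_eq_zero_iff hn)
  rw [hψ.criticalPoints_eq hn,
    hψ.encard_preimages_of_notMem (hψ.zero_mem_compl_factorDomain h hn).2, hfibre,
    encard_singleton, mul_one]

theorem factorBowenSeries_criticalPoint (hψ : IsTopologicalDeformation h ψ) (hn : 2 ≤ n) {z : ℂ}
    (hz : z ∈ criticalPoints h ψ) : factorBowenSeries h ψ z = 0 :=
  (hψ.deriv_factorBowenSeries_eq_zero_iff hn hz.1).1 hz.2

theorem criticalPoints_subset (hψ : IsTopologicalDeformation h ψ) (hn : 2 ≤ n) :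
    criticalPoints h ψ ⊆ factorPreimage h ψ (Metric.closedBall 0 1 \ factorDomain n p ψ) :=
  fun _ hz => ⟨interior_subset hz.1, by
    rw [hψ.factorBowenSeries_criticalPoint hn hz]
    exact hψ.zero_mem_compl_factorDomain h hn⟩

theorem analyticOrderAt_deriv_criticalPoint (hψ : IsTopologicalDeformation h ψ) (hn : 2 ≤ n)
    {z : ℂ} (hz : z ∈ criticalPoints h ψ) :
    analyticOrderAt (deriv (factorBowenSeries h ψ)) z = (n - 1 : ℕ) := by
  refine analyticOrderAt_deriv_of_pos (hψ.analyticOnNhd_factorBowenSeries z hz.1) ?_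
  rw [hψ.analyticOrderAt_of_eq_zero hz.1 (hψ.factorBowenSeries_criticalPoint hn hz)]
  exact_mod_cast (Nat.sub_add_cancel (one_le_two.trans hn)).symm

end IsTopologicalDeformation

end

/-! ### The action on the circle -/

section CircleLift

variable {d : ℕ} {f : Circle → Circle} {F : ℝ →+c[2 * Real.pi, d • (2 * Real.pi)] ℝ}
  {E : ℝ →+c[2 * Real.pi, 2 * Real.pi] ℝ}

theorem conjugateToPower_of_lift (hd : 2 ≤ d) (hF : Continuous F)
    (hexp : StrictMono fun x => F x - x) (hE : Continuous E) (hEmono : StrictMono E)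
    (hf : ∀ x, f (Circle.exp (E x)) = Circle.exp (E (F x))) : ConjugateToPower f d := by
  obtain ⟨g, hg, hgmono, hgF⟩ := exists_strictMono_semiconj_mul Real.two_pi_pos hd F hF hexp
  obtain ⟨G, hG⟩ := exists_circleHomeomorph_of_lift g hg hgmono
  obtain ⟨H, hH⟩ := exists_circleHomeomorph_of_lift E hE hEmono
  refine ⟨G.symm.trans H, fun z => ?_⟩
  obtain ⟨u, rfl⟩ := G.surjective z
  obtain ⟨x, rfl⟩ := Circle.exp_surjective u
  have hpow : G (Circle.exp x) ^ d = G (Circle.exp (F x)) := by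
    rw [hG, hG, hgF, Circle.exp_natCast_mul]
  rw [hpow, Homeomorph.trans_apply, Homeomorph.trans_apply, G.symm_apply_apply,
    G.symm_apply_apply, hH, hH, hf]

theorem orientationPreserving_of_lift (hF : Continuous F) (hFmono : StrictMono F)
    (hE : Continuous E) (hEmono : StrictMono E)
    (hf : ∀ x, f (Circle.exp (E x)) = Circle.exp (E (F x))) :
    OrientationPreserving (fun u => (f u : ℂ)) := by
  set e : ℝ ≃o ℝ := hEmono.orderIsoOfSurjective E
    (surjective_of_continuous_addConstMap Real.two_pi_pos E hE)
  refine ⟨fun y => E (F (e.symm y)), hE.comp (hF.comp e.symm.continuous),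
    hEmono.comp (hFmono.comp e.symm.strictMono), fun y => ?_⟩
  rw [← hf (e.symm y)]
  congr 3
  exact (e.apply_symm_apply y).symm

theorem map_add_two_pi_le_of_lift {φ : Circle → ℂ} (hφ : Function.Injective φ) {L : ℝ → ℝ}
    (hLcont : Continuous L) (hL : ∀ t, φ (Circle.exp t) = Circle.exp (L t)) (t : ℝ) :
    L (t + 2 * Real.pi) ≤ L t + 2 * Real.pi := by
  by_contra! hlt
  obtain ⟨t', ⟨htt', ht't⟩, hLt'⟩ := intermediate_value_Ioo
    (by linarith [Real.two_pi_pos] : t ≤ t + 2 * Real.pi) hLcont.continuousOn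
    (show L t + 2 * Real.pi ∈ _ from ⟨by linarith [Real.two_pi_pos], hlt⟩)
  have hexp : Circle.exp t' = Circle.exp t :=
    hφ (by rw [hL, hL, hLt', Circle.exp_add_two_pi])
  obtain ⟨m, rfl⟩ := Circle.exp_eq_exp.1 hexp
  have hm0 : (0 : ℝ) < m := pos_of_mul_pos_left (by linarith) Real.two_pi_pos.le
  have hm1 : (m : ℝ) < 1 := by
    refine lt_of_mul_lt_mul_right ?_ Real.two_pi_pos.le
    linarith
  norm_cast at hm0 hm1
  omega

end CircleLift

theorem exists_analyticAt_root_of_sub_lt_two_pi (n : ℕ) {a b : ℝ} (hab : b - a < 2 * Real.pi) :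
    ∃ ρ : ℂ → ℂ, ∀ x ∈ Icc a b, AnalyticAt ℂ ρ (Circle.exp x) ∧
      ρ (Circle.exp x) = Circle.exp (x / n) := by
  set c := (a + b) / 2 with hc
  refine ⟨fun w => Circle.exp (c / n) * Complex.exp (Complex.log (w * Circle.exp (-c)) / n),
    fun x hx => ?_⟩
  have hlo : -Real.pi < x - c := by linarith [hx.1]
  have hhi : x - c < Real.pi := by linarith [hx.2]
  have hrot : (Circle.exp x * Circle.exp (-c) : ℂ) = Circle.exp (x - c) := by
    rw [← Circle.coe_mul, ← Circle.exp_add, sub_eq_add_neg]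
  have hslit : (Circle.exp x * Circle.exp (-c) : ℂ) ∈ slitPlane := by
    rw [hrot, mem_slitPlane_iff_arg, Circle.arg_exp hlo hhi.le]
    exact ⟨hhi.ne, Circle.coe_ne_zero _⟩
  have hlog : Complex.log (Circle.exp (x - c)) = (x - c : ℝ) * I := by
    rw [Circle.coe_exp, Complex.log_exp (by simpa using hlo) (by simpa using hhi.le)]
  constructor
  · have hmul : AnalyticAt ℂ (fun w : ℂ => w * Circle.exp (-c)) (Circle.exp x) := by fun_prop
    exact analyticAt_const.mul (hmul.clog hslit).div_const.cexp
  · have hdiv : ((x - c : ℝ) * I / n : ℂ) = ((x - c) / n : ℝ) * I := by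
      push_cast
      ring
    simp only [hrot]
    rw [hlog, hdiv, ← Circle.coe_exp, ← Circle.coe_mul, ← Circle.exp_add, ← add_div,
      add_sub_cancel]

section

variable {n p : ℕ}

/-- The base lift on the scale of the quotient circle: the lift of the factor Bowen-Series map of
the base group itself. -/
def scaledLift (h : 3 ≤ n * p) : ℝ →+c[2 * Real.pi, (n * p - 1) • (2 * Real.pi)] ℝ where
  toFun x := n * baseLift h (x / n)
  map_add_const' x := by
    have hshift : (x + 2 * Real.pi) / n = x / n + p • (2 * halfAngle n p) := by
      rw [add_div, two_pi_div_eq h, nsmul_eq_mul]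
      ring
    rw [hshift, AddConstMapClass.map_add_nsmul, nsmul_eq_mul, nsmul_eq_mul,
      Nat.cast_sub (by omega)]
    push_cast
    linear_combination (-2 : ℝ) * halfAngle_mul h

theorem scaledLift_apply (h : 3 ≤ n * p) (x : ℝ) : scaledLift h x = n * baseLift h (x / n) := rfl

theorem continuous_scaledLift (h : 3 ≤ n * p) : Continuous (scaledLift h) :=
  continuous_const.mul ((continuous_baseLift h).comp (continuous_id.div_const _))

theorem strictMono_scaledLift_sub_self (h : 3 ≤ n * p) :
    StrictMono fun x => scaledLift h x - x := fun x y hxy => by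
  have hn : (0 : ℝ) < n := by exact_mod_cast pos_of_three_le h
  have hlt := mul_lt_mul_of_pos_left
    (strictMono_baseLift_sub_self h (div_lt_div_of_pos_right hxy hn)) hn
  simpa only [scaledLift_apply, mul_sub, mul_div_cancel₀ _ hn.ne'] using hlt

theorem bdry_exp_div_mem_halfPlane (h : 3 ≤ n * p) (s : Fin p) {k : ℕ} (hk : s = k / 2) {x : ℝ}
    (hx : x ∈ Icc (k * (n * halfAngle n p)) ((k + 1 : ℕ) * (n * halfAngle n p))) :
    bdry (Circle.exp (x / n)) ∈ halfPlane n p (zeroIndex h) s := by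
  have hα := halfAngle_pos h
  have hn : (0 : ℝ) < n := by exact_mod_cast pos_of_three_le h
  have hlower : (2 * s : ℝ) ≤ k := by exact_mod_cast (by omega : 2 * (s : ℕ) ≤ k)
  have hupper : ((k + 1 : ℕ) : ℝ) ≤ 2 * (s + 1) := by
    exact_mod_cast (by omega : k + 1 ≤ 2 * ((s : ℕ) + 1))
  apply bdry_mem_halfPlane h
  rw [zero_mul, zero_add]
  apply abs_sub_midAngle_le
  rw [mem_Icc, le_div_iff₀ hn, div_le_iff₀ hn]
  constructor
  · calc 2 * halfAngle n p * s * n = 2 * s * (n * halfAngle n p) := by ring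
      _ ≤ k * (n * halfAngle n p) := by gcongr
      _ ≤ x := hx.1
  · calc x ≤ (k + 1 : ℕ) * (n * halfAngle n p) := hx.2
      _ ≤ 2 * (s + 1) * (n * halfAngle n p) := by gcongr
      _ = 2 * halfAngle n p * (s + 1) * n := by ring

variable {h : 3 ≤ n * p} {ψ : Disk ≃ₜ Disk}

namespace IsTopologicalDeformation

theorem exists_boundaryLift (hψ : IsTopologicalDeformation h ψ) :
    ∃ L : ℝ →+c[2 * Real.pi / n, 2 * Real.pi / n] ℝ, Continuous L ∧ StrictMono L ∧
      ∀ t, (ψ (bdry (Circle.exp t)) : ℂ) = Circle.exp (L t) := by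
  obtain ⟨L, hLcont, hLmono, hL⟩ := hψ.orientationPreserving
  replace hL (t : ℝ) : (ψ (bdry (Circle.exp t)) : ℂ) = Circle.exp (L t) := hL t
  have hn : (1 : ℝ) ≤ n := by exact_mod_cast pos_of_three_le h
  have hpos : 0 < 2 * Real.pi / n := by positivity
  have hle : 2 * Real.pi / n ≤ 2 * Real.pi := div_le_self Real.two_pi_pos.le hn
  have hinj : (fun u => (ψ (bdry u) : ℂ)).Injective :=
    Subtype.val_injective.comp (ψ.injective.comp bdry_injective)
  refine ⟨⟨L, fun t => ?_⟩, hLcont, hLmono, hL⟩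
  have hrot : bdry (Circle.exp (t + 2 * Real.pi / n)) = rot (omega n) (bdry (Circle.exp t)) := by
    rw [add_comm, Circle.exp_add]
    rfl
  have hexp : Circle.exp (L (t + 2 * Real.pi / n)) = Circle.exp (L t + 2 * Real.pi / n) := by
    apply Circle.ext
    rw [← hL, hrot, hψ.map_omega, add_comm (L t), Circle.exp_add, Circle.coe_mul, ← hL]
    rfl
  obtain ⟨m, hm⟩ := Circle.exp_eq_exp.1 hexp
  have hlower : L t < L (t + 2 * Real.pi / n) := hLmono (by linarith)
  have hupper : L (t + 2 * Real.pi / n) ≤ L t + 2 * Real.pi :=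
    (hLmono.monotone (by linarith)).trans (map_add_two_pi_le_of_lift hinj hLcont hL t)
  have hm0 : (-1 : ℝ) < m := lt_of_mul_lt_mul_right (by linarith) Real.two_pi_pos.le
  have hm1 : (m : ℝ) < 1 := lt_of_mul_lt_mul_right (by linarith) Real.two_pi_pos.le
  norm_cast at hm0 hm1
  obtain rfl : m = 0 := by omega
  simpa only [Int.cast_zero, zero_mul, add_zero] using hm

theorem exists_quotientLift (hψ : IsTopologicalDeformation h ψ) :
    ∃ E : ℝ →+c[2 * Real.pi, 2 * Real.pi] ℝ, Continuous E ∧ StrictMono E ∧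
      ∀ x, (ψ (bdry (Circle.exp (x / n))) : ℂ) = Circle.exp (E x / n) := by
  have hn : (0 : ℝ) < n := by exact_mod_cast pos_of_three_le h
  obtain ⟨L, hLcont, hLmono, hL⟩ := hψ.exists_boundaryLift
  refine ⟨⟨fun x => n * L (x / n), fun x => ?_⟩, hLcont.comp (continuous_id.div_const _)
    |>.const_mul _, fun x y hxy => ?_, fun x => ?_⟩
  · rw [add_div, AddConstMapClass.map_add_const, mul_add, mul_div_cancel₀ _ hn.ne']
  · exact mul_lt_mul_of_pos_left (hLmono (div_lt_div_of_pos_right hxy hn)) hn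
  · rw [hL]
    congr 2
    exact (mul_div_cancel_left₀ _ hn.ne').symm

theorem exists_analyticAt_eq_factorBowenSeries (hψ : IsTopologicalDeformation h ψ) (s : Fin p)
    {a b : ℝ} (hab : b - a < 2 * Real.pi) :
    ∃ G : ℂ → ℂ, ∀ x ∈ Icc a b, ∀ z ∈ halfPlane n p (zeroIndex h) s,
      (ψ z : ℂ) = Circle.exp (x / n) →
        AnalyticAt ℂ G (Circle.exp x) ∧ G (Circle.exp x) = factorBowenSeries h ψ (quo n ψ z) := by
  obtain ⟨ρ, hρ⟩ := exists_analyticAt_root_of_sub_lt_two_pi n hab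
  obtain ⟨c, d, hcd, hM⟩ := hψ.exists_moebius s
  refine ⟨fun w => moebius c d (ρ w) ^ n, fun x hx z hz hzx => ?_⟩
  obtain ⟨hρanalytic, hρx⟩ := hρ x hx
  have hmoebius : AnalyticAt ℂ (moebius c d) (ρ (Circle.exp x)) := by
    rw [hρx]
    exact analyticAt_moebius hcd (Circle.norm_coe _).le
  refine ⟨(hmoebius.comp hρanalytic).pow n, ?_⟩
  rw [hψ.factorBowenSeries_quo_of_mem_halfPlane h hz, quo, hM, hzx, ← hρx]

/-- The circle map that the factor Bowen-Series map induces. -/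
def circleMap (hψ : IsTopologicalDeformation h ψ) (u : Circle) : Circle :=
  ⟨factorBowenSeries h ψ u,
    mem_sphere_zero_iff_norm.2 (hψ.norm_factorBowenSeries_eq_one h (Circle.norm_coe u))⟩

theorem coe_circleMap (hψ : IsTopologicalDeformation h ψ) (u : Circle) :
    (hψ.circleMap u : ℂ) = factorBowenSeries h ψ u := rfl

/-- The lift of the circle homeomorphism induced by `ψ` on the quotient by `M_ω`. -/
def quotientLift (hψ : IsTopologicalDeformation h ψ) : ℝ →+c[2 * Real.pi, 2 * Real.pi] ℝ :=
  hψ.exists_quotientLift.choose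

theorem continuous_quotientLift (hψ : IsTopologicalDeformation h ψ) : Continuous hψ.quotientLift :=
  hψ.exists_quotientLift.choose_spec.1

theorem strictMono_quotientLift (hψ : IsTopologicalDeformation h ψ) : StrictMono hψ.quotientLift :=
  hψ.exists_quotientLift.choose_spec.2.1

theorem map_bdry_exp_div (hψ : IsTopologicalDeformation h ψ) (x : ℝ) :
    (ψ (bdry (Circle.exp (x / n))) : ℂ) = Circle.exp (hψ.quotientLift x / n) :=
  hψ.exists_quotientLift.choose_spec.2.2 x

theorem quo_bdry_exp_div (hψ : IsTopologicalDeformation h ψ) (x : ℝ) :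
    quo n ψ (bdry (Circle.exp (x / n))) = Circle.exp (hψ.quotientLift x) := by
  have hn : (n : ℝ) ≠ 0 := by exact_mod_cast (pos_of_three_le h).ne'
  rw [quo, hψ.map_bdry_exp_div, ← Circle.coe_pow, ← Circle.exp_natCast_mul, mul_div_cancel₀ _ hn]

theorem circleMap_exp_quotientLift (hψ : IsTopologicalDeformation h ψ) (x : ℝ) :
    hψ.circleMap (Circle.exp (hψ.quotientLift x)) =
      Circle.exp (hψ.quotientLift (scaledLift h x)) := by
  have hn : (n : ℝ) ≠ 0 := by exact_mod_cast (pos_of_three_le h).ne'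
  apply Circle.ext
  rw [coe_circleMap, ← quo_bdry_exp_div, hψ.factorBowenSeries_quo_bdry, ← quo_bdry_exp_div,
    scaledLift_apply, mul_div_cancel_left₀ _ hn]

theorem conjugateToPower_circleMap (hψ : IsTopologicalDeformation h ψ) :
    ConjugateToPower hψ.circleMap (n * p - 1) :=
  conjugateToPower_of_lift (by omega) (continuous_scaledLift h) (strictMono_scaledLift_sub_self h)
    hψ.continuous_quotientLift hψ.strictMono_quotientLift hψ.circleMap_exp_quotientLift

theorem orientationPreserving_circleMap (hψ : IsTopologicalDeformation h ψ) :
    OrientationPreserving (fun u => (hψ.circleMap u : ℂ)) :=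
  orientationPreserving_of_lift (continuous_scaledLift h)
    (strictMono_of_strictMono_sub_self (strictMono_scaledLift_sub_self h))
    hψ.continuous_quotientLift hψ.strictMono_quotientLift hψ.circleMap_exp_quotientLift

/-- The circle is cut into half-arcs of the polygon, which are shorter than the circle even for
`p = 1`, so that the `n`-th root has an analytic branch on each of them. -/
theorem piecewiseAnalytic_circleMap (hψ : IsTopologicalDeformation h ψ) :
    PiecewiseAnalytic hψ.circleMap := by
  have hE := hψ.strictMono_quotientLift
  have hp : 1 ≤ p := Nat.pos_of_ne_zero (by rintro rfl; omega)
  set β := n * halfAngle n p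
  have hβp : 2 * (p * β) = 2 * Real.pi := by linear_combination 2 * halfAngle_mul h
  have hβ0 : 0 < β := mul_pos (by exact_mod_cast pos_of_three_le h) (halfAngle_pos h)
  have hβlt : β < 2 * Real.pi := by
    have : 1 * β ≤ p * β := by
      gcongr
      exact_mod_cast hp
    linarith
  have hperiod : hψ.quotientLift ((2 * p : ℕ) * β) =
      hψ.quotientLift ((0 : ℕ) * β) + 2 * Real.pi := by
    rw [← AddConstMapClass.map_add_const, Nat.cast_mul, Nat.cast_ofNat, mul_assoc, hβp,
      Nat.cast_zero, zero_mul, zero_add]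
  refine ⟨2 * p, fun k => hψ.quotientLift (k * β), fun i j hij => hE (by gcongr), hperiod,
    fun k hk => ?_⟩
  have harc : hψ.quotientLift ((k + 1 : ℕ) * β) - hψ.quotientLift (k * β) < 2 * Real.pi := by
    rw [sub_lt_iff_lt_add', ← AddConstMapClass.map_add_const]
    refine hE ?_
    rw [Nat.cast_succ, add_one_mul]
    gcongr
  obtain ⟨G, hG⟩ := hψ.exists_analyticAt_eq_factorBowenSeries ⟨k / 2, by omega⟩ harc
  refine ⟨G, fun y hy => ?_⟩
  obtain ⟨x, rfl⟩ := surjective_of_continuous_addConstMap Real.two_pi_pos _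
    hψ.continuous_quotientLift y
  have hx : x ∈ Icc (k * β) ((k + 1 : ℕ) * β) := ⟨hE.le_iff_le.1 hy.1, hE.le_iff_le.1 hy.2⟩
  rw [coe_circleMap]
  simpa only [hψ.quo_bdry_exp_div] using
    hG _ hy _ (bdry_exp_div_mem_halfPlane h _ rfl hx) (hψ.map_bdry_exp_div x)

end IsTopologicalDeformation

theorem pairingOne_mem_baseGroup (h : 3 ≤ n * p) (s : Fin p) : pairingOne h s ∈ baseGroup h := by
  refine Subgroup.subset_closure ⟨zeroIndex h, s, ?_⟩
  simp [pairing]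

theorem InducesTeichOmega.isTopologicalDeformation (hψ : InducesTeichOmega h ψ) :
    IsTopologicalDeformation h ψ where
  norm_lt_one_iff := hψ.quasiconformal.1
  map_omega := hψ.map_omega
  orientationPreserving := hψ.quasiconformal.2.1
  isDiskAut_conj s := hψ.conj_mem _ (pairingOne_mem_baseGroup h s)

end

end

end FactorBS

open FactorBS in
theorem mainTheorem5_general (n p : ℕ) (h : 3 ≤ n * p) (ψ : Disk ≃ₜ Disk)
    (hψ : IsTopologicalDeformation h ψ) :
    ((∀ z ∈ bowenSeriesDomain n p ψ,
        factorBowenSeries h ψ ((z : ℂ) ^ n) = (bowenSeries h ψ z : ℂ) ^ n) ∧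
      Set.MapsTo (factorBowenSeries h ψ) (factorDomain n p ψ) (Metric.closedBall 0 1) ∧
      ContinuousOn (factorBowenSeries h ψ) (factorDomain n p ψ) ∧
      AnalyticOnNhd ℂ (factorBowenSeries h ψ) (interior (factorDomain n p ψ))) ∧
    (Metric.sphere 0 1 ⊆ factorDomain n p ψ ∧
      ∃ f : Circle → Circle, (∀ z : Circle, (f z : ℂ) = factorBowenSeries h ψ z) ∧
        PiecewiseAnalytic f ∧ OrientationPreserving (fun z => (f z : ℂ)) ∧ Expansive f ∧
        IsCoveringOfDegree f (n * p - 1) ∧ ConjugateToPower f (n * p - 1)) ∧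
    (HasDegree (factorBowenSeries h ψ) (factorPreimage h ψ (interior (factorDomain n p ψ)))
        (interior (factorDomain n p ψ)) (n * p - 1) ∧
      Set.BijOn (factorBowenSeries h ψ) (boundaryCurves n p ψ) (boundaryCurves n p ψ) ∧
      ∀ w ∈ factorDomain n p ψ,
        (factorPreimage h ψ {w} \ boundaryCurves n p ψ).Finite ∧
        (factorPreimage h ψ {w} \ boundaryCurves n p ψ).ncard = n * p - 1) ∧
    HasDegree (factorBowenSeries h ψ)
      (factorPreimage h ψ (Metric.closedBall 0 1 \ factorDomain n p ψ))
      (Metric.closedBall 0 1 \ factorDomain n p ψ) (n * p) ∧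
    (2 ≤ n →
      (criticalPoints h ψ).Finite ∧ (criticalPoints h ψ).ncard = p ∧
      criticalPoints h ψ ⊆ factorPreimage h ψ (Metric.closedBall 0 1 \ factorDomain n p ψ) ∧
      ∀ z ∈ criticalPoints h ψ, factorBowenSeries h ψ z = 0 ∧
        analyticOrderAt (deriv (factorBowenSeries h ψ)) z = ((n - 1 : ℕ) : ℕ∞)) := by
  refine ⟨⟨?_, hψ.mapsTo_factorBowenSeries h, hψ.continuousOn_factorBowenSeries h,
    hψ.analyticOnNhd_factorBowenSeries⟩, ⟨hψ.sphere_subset_factorDomain h, hψ.circleMap,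
    hψ.coe_circleMap, hψ.piecewiseAnalytic_circleMap, hψ.orientationPreserving_circleMap,
    hψ.conjugateToPower_circleMap.expansive (by omega),
    hψ.conjugateToPower_circleMap.isCoveringOfDegree (by omega),
    hψ.conjugateToPower_circleMap⟩,
    ⟨hψ.hasDegree_interior, hψ.bijOn_boundaryCurves h, fun w hw => ?_⟩, hψ.hasDegree_compl,
    fun hn => ?_⟩
  · rintro _ ⟨z, hz, rfl⟩
    rw [bowenSeries, ψ.symm_apply_apply]
    exact hψ.factorBowenSeries_quo h hz
  · have hcard := hψ.encard_preimages_of_mem (h := h) hw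
    exact ⟨Set.finite_of_encard_eq_coe hcard, by rw [Set.ncard, hcard, ENat.toNat_natCast]⟩
  · have hcard := hψ.encard_criticalPoints hn
    exact ⟨Set.finite_of_encard_eq_coe hcard, by rw [Set.ncard, hcard, ENat.toNat_natCast],
      hψ.criticalPoints_subset hn, fun z hz => ⟨hψ.factorBowenSeries_criticalPoint hn hz,
        hψ.analyticOrderAt_deriv_criticalPoint hn hz⟩⟩

open FactorBS in
theorem mainTheorem5 (n p : ℕ) (h : 3 ≤ n * p) (ψ : Disk ≃ₜ Disk)
    (hψ : InducesTeichOmega h ψ) :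
    -- the factor map is well defined and continuous, and holomorphic in the interior of `𝒟_Γ`
    ((∀ z ∈ bowenSeriesDomain n p ψ,
        factorBowenSeries h ψ ((z : ℂ) ^ n) = (bowenSeries h ψ z : ℂ) ^ n) ∧
      Set.MapsTo (factorBowenSeries h ψ) (factorDomain n p ψ) (Metric.closedBall 0 1) ∧
      ContinuousOn (factorBowenSeries h ψ) (factorDomain n p ψ) ∧
      AnalyticOnNhd ℂ (factorBowenSeries h ψ) (interior (factorDomain n p ψ))) ∧
    -- the action on the circle
    (Metric.sphere 0 1 ⊆ factorDomain n p ψ ∧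
      ∃ f : Circle → Circle, (∀ z : Circle, (f z : ℂ) = factorBowenSeries h ψ z) ∧
        PiecewiseAnalytic f ∧ OrientationPreserving (fun z => (f z : ℂ)) ∧ Expansive f ∧
        IsCoveringOfDegree f (n * p - 1) ∧ ConjugateToPower f (n * p - 1)) ∧
    -- the degree over `𝒟_Γ`: over its interior, and (the boundary curves in the open disk being
    -- mapped bijectively onto themselves) over all of it, off these curves
    (HasDegree (factorBowenSeries h ψ) (factorPreimage h ψ (interior (factorDomain n p ψ)))
        (interior (factorDomain n p ψ)) (n * p - 1) ∧
      Set.BijOn (factorBowenSeries h ψ) (boundaryCurves n p ψ) (boundaryCurves n p ψ) ∧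
      ∀ w ∈ factorDomain n p ψ,
        (factorPreimage h ψ {w} \ boundaryCurves n p ψ).Finite ∧
        (factorPreimage h ψ {w} \ boundaryCurves n p ψ).ncard = n * p - 1) ∧
    -- the degree over the complement of `𝒟_Γ`
    HasDegree (factorBowenSeries h ψ)
      (factorPreimage h ψ (Metric.closedBall 0 1 \ factorDomain n p ψ))
      (Metric.closedBall 0 1 \ factorDomain n p ψ) (n * p) ∧
    -- the critical points
    (2 ≤ n →
      (criticalPoints h ψ).Finite ∧ (criticalPoints h ψ).ncard = p ∧
      criticalPoints h ψ ⊆ factorPreimage h ψ (Metric.closedBall 0 1 \ factorDomain n p ψ) ∧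
      ∀ z ∈ criticalPoints h ψ, factorBowenSeries h ψ z = 0 ∧
        analyticOrderAt (deriv (factorBowenSeries h ψ)) z = ((n - 1 : ℕ) : ℕ∞)) :=
  mainTheorem5_general n p h ψ hψ.isTopologicalDeformation
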